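/- **Setting.** $\mathrm{LTL}_f$ formulas are in negation normal form, built from $\mathit{tt},\mathit{ff}$, literals $p,\neg p$, $\wedge,\vee$, strong next $\circ$, weak next $\bullet$, until $\mathcal U$ and release $\mathcal R$, with the usual semantics $\rho\models\varphi$ on non-empty finite traces $\rho$ of letters (sets of atoms). Let $X,Y$ be disjoint finite sets of atoms and let $\varphi$ be a formula over $X\cup Y$. The specification $(\varphi,X,Y)_{Moore}$ is *realizable* if there is $g:(2^X)^*\to 2^Y$ such that for every infinite sequence $X_0,X_1,\dots$ of subsets of $X$ there is $k\ge 0$ with $(X_0\cup g(\epsilon)),(X_1\cup g(X_0)),\dots,(X_k\cup g(X_0,\dots,X_{k-1}))\models\varphi$. Let $tcl(\varphi)$ be the set of the subformulas of $\varphi$ that are literals or have one of $\circ,\bullet,\mathcal U,\mathcal R$ at the root. Two formulas are *propositionally equivalent* ($\sim$) if they are equivalent as Boolean combinations of literals and formulas with a temporal root, all of which are treated as independent propositional variables. The *progression* $fp(\varphi,\sigma)$ through a letter $\sigma$ is: $fp(\mathit{tt},\sigma)=\mathit{tt}$, $fp(\mathit{ff},\sigma)=\mathit{ff}$; $fp(l,\sigma)$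 is $\mathit{tt}$ or $\mathit{ff}$ according to whether $\sigma\models l$, for a literal $l$; $fp$ commutes with $\wedge,\vee$; $fp(\circ\varphi,\sigma)=fp(\bullet\varphi,\sigma)=\varphi$; $fp(\varphi\,\mathcal U\,\psi,\sigma)=fp(\psi,\sigma)\vee(fp(\varphi,\sigma)\wedge\varphi\,\mathcal U\,\psi)$; $fp(\varphi\,\mathcal R\,\psi,\sigma)=fp(\psi,\sigma)\wedge(fp(\varphi,\sigma)\vee\varphi\,\mathcal R\,\psi)$. A *state* is a $\sim$-class of formulas; $fp(s,\sigma)$ and $\sigma\models s$ (with $\sigma$ read as a trace of length one) are well defined for states $s$. **Algorithm.** On input $(\varphi,X,Y)_{Moore}$ the algorithm keeps sets of states $swin,ewin,undet$ and sets of edges $(s,\sigma)$, $\sigma\subseteq X\cup Y$, $swinT,ewinT,undetT$, all empty at first, puts $[\varphi]_\sim$ into $undet$, calls $forwardSearch([\varphi]_\sim)$, and answers "Realizable" if then $[\varphi]_\sim\in swin$, and "Unrealizable" otherwise. $forwardSearch(s)$: 1. *Status check.* If $s\in swin$, or there is $y\subseteq Y$ such that for all $x\subseteq X$, $x\cup y\models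 s$ or $fp(s,x\cup y)\in swin$, then $s$ is moved from $undet$ to $swin$; go to 3. Otherwise, if $s\in ewin$, or for all $y\subseteq Y$ there is $x\subseteq X$ with $x\cup y\not\models s$ and $fp(s,x\cup y)\in\{s\}\cup ewin$, then $s$ is moved from $undet$ to $ewin$; go to 3. The first test puts all edges $(s,\sigma)$ with $\sigma\models s$ or $fp(s,\sigma)\in swin$ into $swinT$; the second puts all edges $(s,\sigma)$ with $\sigma\not\models s$ and $fp(s,\sigma)\in\{s\}\cup ewin$ into $ewinT$. If the status stays unknown, list the edges $\sigma=x\cup y$ ($x\subseteq X$, $y\subseteq Y$) such that no $(s,x'\cup y)$ with $x'\subseteq X$ is in $ewinT$ and $(s,\sigma)\notin swinT\cup undetT$. 2. Take any edge $\sigma$ off the list; if the list is empty, go to 3. If $fp(s,\sigma)\in undet$, put $(s,\sigma)$ into $undetT$ and repeat 2 (no state has been classified, so the status of $s$ is still unknown). Otherwise put $fp(s,\sigma)$ into $undet$, call $forwardSearch(fp(s,\sigma))$ and, when it returns, go to 1. 3. If $s$ is the root of a strongly connected component $C$, as detected by Tarjan's algorithm (visit numbers, low-links, a stack) along the edges traversed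 in step 2, then pop $C$ and call $backwardSearch(C)$. Return. $backwardSearch(C)$: start with $cur=swin\cap C$. In each round, the candidates are the states of $C\cap undet$ that have an edge to a state of $cur$; each of them, in any order, is tested by the first test of step 1 and, if it passes, is moved to $swin$. If some passed, they form the next $cur$, and there is another round. If none passed, the states of $C\setminus swin$ are put into $ewin$, all of $C$ is removed from $undet$, and the search ends. Time is the number of elementary operations. One operation covers the work on one edge in one pass through a loop over the edges of a state (computing $fp(s,\sigma)$ as a state, testing $\sigma\models s$, and testing, inserting or removing states or edges in the global sets), the work on one element of a component in one pass over that component, or one step of control. Every pass through a loop over the edges of a state is charged all of its $2^{|X\cup Y|}$ edges, even if it could be left early; in particular each of the two tests and the listing in step 1, and the test of each candidate, is charged $2^{|X\cup Y|}$ operations, and the computation of the candidates of a round is charged $|C|\cdot 2^{|X\cup Y|}$. **Theorem.** For every $\mathrm{LTL}_f$ specification $(\varphi,X,Y)_{Moore}$, whatever choices the algorithm makes: 1. The algorithm terminates with an answer within time $O\bigl(2^{|X\cup Y|}\cdot 2^{2^{|tcl(\varphi)|}}\bigr)$, with an absolute constant. 2. The algorithm returns "Realizable" if and only if $(\varphi,X,Y)_{Moore}$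 is realizable (and "Unrealizable" if and only if it is not). -/

import Mathlib

universe u

/-! ## Linear temporal logic over finite traces -/

/-- `LTL_f` formulas in negation normal form over a type `α` of atomic propositions. -/
inductive LTLf (α : Type u) : Type u where
  | tt : LTLf α
  | ff : LTLf α
  | pos (p : α) : LTLf α
  | neg (p : α) : LTLf α
  | and (φ ψ : LTLf α) : LTLf α
  | or (φ ψ : LTLf α) : LTLf α
  | next (φ : LTLf α) : LTLf α
  | wnext (φ : LTLf α) : LTLf α
  | untl (φ ψ : LTLf α) : LTLf α
  | rels (φ ψ : LTLf α) : LTLf α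
  deriving DecidableEq

namespace LTLf

/-- The atoms occurring in a formula. -/
def atoms {α : Type u} [DecidableEq α] : LTLf α → Finset α
  | tt => ∅
  | ff => ∅
  | pos p => {p}
  | neg p => {p}
  | and φ ψ => φ.atoms ∪ ψ.atoms
  | or φ ψ => φ.atoms ∪ ψ.atoms
  | next φ => φ.atoms
  | wnext φ => φ.atoms
  | untl φ ψ => φ.atoms ∪ ψ.atoms
  | rels φ ψ => φ.atoms ∪ ψ.atoms

/-- The temporal closure: the subformulas that are literals or whose root is one of the temporal
operators (strong next, weak next, until, release). -/
def tcl {α : Type u} [DecidableEq α] : LTLf α → Finset (LTLf α)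
  | tt => ∅
  | ff => ∅
  | pos p => {pos p}
  | neg p => {neg p}
  | and φ ψ => φ.tcl ∪ ψ.tcl
  | or φ ψ => φ.tcl ∪ ψ.tcl
  | next φ => insert (next φ) φ.tcl
  | wnext φ => insert (wnext φ) φ.tcl
  | untl φ ψ => insert (untl φ ψ) (φ.tcl ∪ ψ.tcl)
  | rels φ ψ => insert (rels φ ψ) (φ.tcl ∪ ψ.tcl)

/-- Satisfaction of a formula by a finite trace. A trace is a non-empty list of letters, a letter
being the finite set of the atoms that are true at that instant; `ρ.drop i` is the suffix of `ρ`
from position `i`. (The value on the empty list is never used.) -/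
def Sat {α : Type u} : LTLf α → List (Finset α) → Prop
  | tt, _ => True
  | ff, _ => False
  | pos p, ρ => ∃ a ∈ ρ.head?, p ∈ a
  | neg p, ρ => ∃ a ∈ ρ.head?, p ∉ a
  | and φ ψ, ρ => φ.Sat ρ ∧ ψ.Sat ρ
  | or φ ψ, ρ => φ.Sat ρ ∨ ψ.Sat ρ
  | next φ, ρ => 1 < ρ.length ∧ φ.Sat (ρ.drop 1)
  | wnext φ, ρ => ρ.length = 1 ∨ φ.Sat (ρ.drop 1)
  | untl φ ψ, ρ => ∃ i < ρ.length, ψ.Sat (ρ.drop i) ∧ ∀ j < i, φ.Sat (ρ.drop j)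
  | rels φ ψ, ρ => ∃ i < ρ.length, (i + 1 = ρ.length ∨ φ.Sat (ρ.drop i)) ∧
      ∀ j ≤ i, ψ.Sat (ρ.drop j)

/-! ## Realizability (system moves first: Moore) -/

/-- `(φ, X, Y)_Moore` is realizable: there is a strategy `g : (2^X)^* → 2^Y` such that for every
infinite sequence `X_0, X_1, …` of subsets of `X` there is `k ≥ 0` such that the trace
`X_0 ∪ g(ε), X_1 ∪ g(X_0), …, X_k ∪ g(X_0, …, X_{k-1})` satisfies `φ`. -/
def MooreRealizable {α : Type u} [DecidableEq α] (φ : LTLf α) (X Y : Finset α) : Prop :=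
  ∃ g : List (Finset α) → Finset α, (∀ h, g h ⊆ Y) ∧
    ∀ x : ℕ → Finset α, (∀ i, x i ⊆ X) →
      ∃ k : ℕ, φ.Sat ((List.range (k + 1)).map fun i => x i ∪ g ((List.range i).map x))

/-! ## Propositional equivalence and formula progression -/

/-- Propositional satisfaction `I ⊨_p φ`: literals and formulas with a temporal root are treated
as propositional variables. -/
def PropSat {α : Type u} (I : Set (LTLf α)) : LTLf α → Prop
  | tt => True
  | ff => False
  | pos p => pos p ∈ I
  | neg p => neg p ∈ I
  | and φ ψ => PropSat I φ ∧ PropSat I ψ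
  | or φ ψ => PropSat I φ ∨ PropSat I ψ
  | next φ => next φ ∈ I
  | wnext φ => wnext φ ∈ I
  | untl φ ψ => untl φ ψ ∈ I
  | rels φ ψ => rels φ ψ ∈ I

/-- Propositional equivalence. -/
def propSetoid (α : Type u) : Setoid (LTLf α) where
  r φ ψ := ∀ I : Set (LTLf α), PropSat I φ ↔ PropSat I ψ
  iseqv := ⟨fun _ _ => Iff.rfl, fun h I => (h I).symm, fun h₁ h₂ I => (h₁ I).trans (h₂ I)⟩

/-- Progression of a formula through one letter. -/
def fp {α : Type u} [DecidableEq α] (σ : Finset α) : LTLf α → LTLf α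
  | tt => tt
  | ff => ff
  | pos p => if p ∈ σ then tt else ff
  | neg p => if p ∈ σ then ff else tt
  | and φ ψ => and (fp σ φ) (fp σ ψ)
  | or φ ψ => or (fp σ φ) (fp σ ψ)
  | next φ => φ
  | wnext φ => φ
  | untl φ ψ => or (fp σ ψ) (and (fp σ φ) (untl φ ψ))
  | rels φ ψ => and (fp σ ψ) (or (fp σ φ) (rels φ ψ))

theorem propSat_fp {α : Type u} [DecidableEq α] (σ : Finset α) (I : Set (LTLf α)) (φ : LTLf α) :
    PropSat I (fp σ φ) ↔ PropSat {χ | PropSat I (fp σ χ)} φ := by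
  induction φ with
  | tt => exact Iff.rfl
  | ff => exact Iff.rfl
  | and φ ψ h₁ h₂ => exact and_congr h₁ h₂
  | or φ ψ h₁ h₂ => exact or_congr h₁ h₂
  | _ => exact Iff.rfl

theorem sat_iff_propSat {α : Type u} (ρ : List (Finset α)) (φ : LTLf α) :
    φ.Sat ρ ↔ PropSat {χ | χ.Sat ρ} φ := by
  induction φ with
  | tt => exact Iff.rfl
  | ff => exact Iff.rfl
  | and φ ψ h₁ h₂ => exact and_congr h₁ h₂
  | or φ ψ h₁ h₂ => exact or_congr h₁ h₂
  | _ => exact Iff.rfl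

/-- The states of the automaton: propositional equivalence classes of formulas. -/
abbrev State (α : Type u) : Type u := Quotient (propSetoid α)

/-- The class of a formula. -/
def cls {α : Type u} (φ : LTLf α) : State α := Quotient.mk (propSetoid α) φ

/-- The transition function of the automaton: progression of a class through a letter. -/
def State.step {α : Type u} [DecidableEq α] (s : State α) (σ : Finset α) : State α :=
  Quotient.map (sa := propSetoid α) (sb := propSetoid α) (fp σ)
    (fun φ ψ h I => by rw [propSat_fp σ I φ, propSat_fp σ I ψ]; exact h _) s

/-- `(s, σ)` is an accepting transition: `σ ⊨ s`, where the letter `σ` is read as a trace of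
length one. -/
def State.Acc {α : Type u} (s : State α) (σ : Finset α) : Prop :=
  Quotient.lift (s := propSetoid α) (fun φ : LTLf α => φ.Sat [σ])
    (fun φ ψ h => propext (by rw [sat_iff_propSat [σ] φ, sat_iff_propSat [σ] ψ]; exact h _)) s

end LTLf

/-! ## The on-the-fly synthesis algorithm

The algorithm is given as a (nondeterministic) small-step machine; every step carries the number of
elementary operations that it is charged. All choices that the algorithm leaves open (which edge
`getEdge` returns, in which order a `for` loop runs through a set) are nondeterministic. -/

namespace OnTheFly

open LTLf

/-- The answer of the algorithm. -/
inductive Verdict : Type where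
  | realizable
  | unrealizable

/-- The global variables: the sets `swin_state`, `ewin_state`, `undetermined_state`,
`swin_transition`, `ewin_transition`, `undetermined_transition`, and the variables of Tarjan's
algorithm (visit numbers, low-links, the next visit number, and Tarjan's stack, top first). -/
structure Store (α : Type u) where
  swin : Set (State α)
  ewin : Set (State α)
  undet : Set (State α)
  swinT : Set (State α × Finset α)
  ewinT : Set (State α × Finset α)
  undetT : Set (State α × Finset α)
  index : State α → ℕ
  low : State α → ℕ
  counter : ℕ
  stack : List (State α)

/-- Program points.
* `loop s`: at the head of the `while` loop of `forwardSearch(s)`, before `checkCurrentStatus(s)`;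
* `explore s W`: in the body of that loop, the status of `s` being unknown; `W` is the set of the
  edges that `getEdge(s)` may still return;
* `exit s`: the loop of `forwardSearch(s)` has been left, before `isSccRoot(s)`;
* `backward s C cur`: in `backwardSearch(C)`, called from `forwardSearch(s)`, at the head of the
  do-while loop, with `cur_swin = cur`;
* `candidates s C cand new`: in the `for` loop of `backwardSearch(C)`; `cand` are the candidates
  still to be checked, and `new` is `new_swin`;
* `return s`: at the end of `forwardSearch(s)`;
* `halt v`: the algorithm has returned `v`. -/
inductive Control (α : Type u) where
  | loop (s : State α)
  | explore (s : State α) (W : Set (Finset α))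
  | exit (s : State α)
  | backward (s : State α) (C : List (State α)) (cur : Set (State α))
  | candidates (s : State α) (C : List (State α)) (cand new : Set (State α))
  | return (s : State α)
  | halt (v : Verdict)

/-- A configuration: the program point, the stack of the pending callers (the states `p` whose
procedure `forwardSearch(p)` waits for a recursive call to return; innermost first), and the global
variables. -/
structure Config (α : Type u) where
  control : Control α
  callers : List (State α)
  store : Store α

/-- `currentSystemWinning(s)`. -/
def SysWinning {α : Type u} [DecidableEq α] (X Y : Finset α) (g : Store α) (s : State α) : Prop :=
  s ∈ g.swin ∨ ∃ y ⊆ Y, ∀ x ⊆ X, s.Acc (x ∪ y) ∨ s.step (x ∪ y) ∈ g.swin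

/-- `currentEnvironmentWinning(s)`. -/
def EnvWinning {α : Type u} [DecidableEq α] (X Y : Finset α) (g : Store α) (s : State α) : Prop :=
  s ∈ g.ewin ∨ ∀ y ⊆ Y, ∃ x ⊆ X, ¬ s.Acc (x ∪ y) ∧
    (s.step (x ∪ y) = s ∨ s.step (x ∪ y) ∈ g.ewin)

/-- The insertions into `swin_transition` made by `currentSystemWinning(s)`: the edges of `s` that
are accepting or lead to a known system-winning state. -/
def Store.recordSwin {α : Type u} [DecidableEq α] (X Y : Finset α) (g : Store α) (s : State α) :
    Store α :=
  { g with swinT := g.swinT ∪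
      {e | e.1 = s ∧ ∃ x ⊆ X, ∃ y ⊆ Y, e.2 = x ∪ y ∧ (s.Acc (x ∪ y) ∨ s.step (x ∪ y) ∈ g.swin)} }

/-- The insertions into `ewin_transition` made by `currentEnvironmentWinning(s)`: the edges of `s`
that are not accepting and lead to `s` itself or to a known environment-winning state. -/
def Store.recordEwin {α : Type u} [DecidableEq α] (X Y : Finset α) (g : Store α) (s : State α) :
    Store α :=
  { g with ewinT := g.ewinT ∪
      {e | e.1 = s ∧ ∃ x ⊆ X, ∃ y ⊆ Y, e.2 = x ∪ y ∧ ¬ s.Acc (x ∪ y) ∧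
        (s.step (x ∪ y) = s ∨ s.step (x ∪ y) ∈ g.ewin)} }

/-- `s` is classified as system-winning. -/
def Store.markSwin {α : Type u} (g : Store α) (s : State α) : Store α :=
  { g with swin := insert s g.swin, undet := g.undet \ {s} }

/-- `s` is classified as environment-winning. -/
def Store.markEwin {α : Type u} (g : Store α) (s : State α) : Store α :=
  { g with ewin := insert s g.ewin, undet := g.undet \ {s} }

/-- The system choices for which the environment is known to have a winning response at `s`. -/
def knownEwin {α : Type u} [DecidableEq α] (X Y : Finset α) (g : Store α) (s : State α) :
    Set (Finset α) :=
  {y | y ⊆ Y ∧ ∃ x ⊆ X, (s, x ∪ y) ∈ g.ewinT}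

/-- The environment choices known to be winning for the system at `s` under the choice `y`. -/
def knownSwin {α : Type u} [DecidableEq α] (X : Finset α) (g : Store α) (s : State α)
    (y : Finset α) : Set (Finset α) :=
  {x | x ⊆ X ∧ (s, x ∪ y) ∈ g.swinT}

/-- The environment choices known to lead from `s`, under `y`, to a visited, undetermined state. -/
def knownUndet {α : Type u} [DecidableEq α] (X : Finset α) (g : Store α) (s : State α)
    (y : Finset α) : Set (Finset α) :=
  {x | x ⊆ X ∧ (s, x ∪ y) ∈ g.undetT}

/-- The edges that `getEdge(s)` may return. -/
def openEdges {α : Type u} [DecidableEq α] (X Y : Finset α) (g : Store α) (s : State α) :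
    Set (Finset α) :=
  {e | ∃ x ⊆ X, ∃ y ⊆ Y, e = x ∪ y ∧
    y ∉ knownEwin X Y g s ∧ x ∉ knownSwin X g s y ∧ x ∉ knownUndet X g s y}

open Classical in
/-- Tarjan's bookkeeping on the first visit of `t`. -/
noncomputable def Store.visit {α : Type u} (g : Store α) (t : State α) : Store α :=
  { g with
    undet := insert t g.undet
    index := Function.update g.index t g.counter
    low := Function.update g.low t g.counter
    counter := g.counter + 1
    stack := t :: g.stack }

open Classical in
/-- `low[s] := min(low[s], n)`. -/
noncomputable def Store.lower {α : Type u} (g : Store α) (s : State α) (n : ℕ) : Store α :=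
  { g with low := Function.update g.low s (min (g.low s) n) }

/-- The direct predecessors in `C` of the states in `cur`. -/
def directPredecessors {α : Type u} [DecidableEq α] (X Y : Finset α) (cur : Set (State α))
    (C : List (State α)) : Set (State α) :=
  {s | s ∈ C ∧ ∃ x ⊆ X, ∃ y ⊆ Y, s.step (x ∪ y) ∈ cur}

/-- All global sets are empty. -/
def Store.empty (α : Type u) : Store α where
  swin := ∅
  ewin := ∅
  undet := ∅
  swinT := ∅
  ewinT := ∅
  undetT := ∅
  index := fun _ => 0
  low := fun _ => 0
  counter := 0
  stack := []

/-- The initial configuration: `undetermined_state = {φ}`, and `forwardSearch(φ)` is called. -/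
noncomputable def init {α : Type u} (φ : LTLf α) : Config α :=
  ⟨.loop (cls φ), [], (Store.empty α).visit (cls φ)⟩

/-- `Step φ X Y c k c'`: the algorithm on the input `(φ, X, Y)` can go from `c` to `c'` in one step,
at the cost of `k` elementary operations. An elementary operation is the work on one edge (computing
a successor state, testing acceptance, testing membership of a state or an edge in a global set,
inserting or removing it, in the body of one of the loops over the `2 ^ |X ∪ Y|` edges of a state),
the work on one element of a component, or one unit of control. Loops over edges are charged all of
their iterations, also where they could be left early. -/
inductive Step {α : Type u} [DecidableEq α] (φ : LTLf α) (X Y : Finset α) :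
    Config α → ℕ → Config α → Prop
  /-- `checkCurrentStatus(s)` returns `System-winning`. -/
  | checkSys (s : State α) (ps : List (State α)) (g : Store α) (h : SysWinning X Y g s) :
      Step φ X Y ⟨.loop s, ps, g⟩ (2 ^ (X ∪ Y).card + 1)
        ⟨.exit s, ps, (g.recordSwin X Y s).markSwin s⟩
  /-- `checkCurrentStatus(s)` returns `Environment-winning`. -/
  | checkEnv (s : State α) (ps : List (State α)) (g : Store α) (h : ¬ SysWinning X Y g s)
      (h' : EnvWinning X Y g s) :
      Step φ X Y ⟨.loop s, ps, g⟩ (2 * 2 ^ (X ∪ Y).card + 1)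
        ⟨.exit s, ps, ((g.recordSwin X Y s).recordEwin X Y s).markEwin s⟩
  /-- `checkCurrentStatus(s)` returns `Unknown`; the edges for `getEdge(s)` are listed. -/
  | checkUnknown (s : State α) (ps : List (State α)) (g : Store α) (h : ¬ SysWinning X Y g s)
      (h' : ¬ EnvWinning X Y g s) :
      Step φ X Y ⟨.loop s, ps, g⟩ (3 * 2 ^ (X ∪ Y).card + 1)
        ⟨.explore s (openEdges X Y ((g.recordSwin X Y s).recordEwin X Y s) s), ps,
          (g.recordSwin X Y s).recordEwin X Y s⟩
  /-- `getEdge(s)` returns `Null`. -/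
  | noEdge (s : State α) (ps : List (State α)) (g : Store α) :
      Step φ X Y ⟨.explore s ∅, ps, g⟩ 1 ⟨.exit s, ps, g⟩
  /-- `getEdge(s)` returns an edge to a visited, undetermined state. Since this does not classify
  any state, the status of `s` remains unknown, and the next edge is considered. -/
  | undetEdge (s : State α) (W : Set (Finset α)) (ps : List (State α)) (g : Store α)
      (e : Finset α) (he : e ∈ W) (h : s.step e ∈ g.undet) :
      Step φ X Y ⟨.explore s W, ps, g⟩ 1
        ⟨.explore s (W \ {e}), ps,
          { g.lower s (g.index (s.step e)) with undetT := insert (s, e) g.undetT }⟩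
  /-- `getEdge(s)` returns any other edge: recursive call of `forwardSearch`. -/
  | call (s : State α) (W : Set (Finset α)) (ps : List (State α)) (g : Store α)
      (e : Finset α) (he : e ∈ W) (h : s.step e ∉ g.undet) :
      Step φ X Y ⟨.explore s W, ps, g⟩ 1 ⟨.loop (s.step e), s :: ps, g.visit (s.step e)⟩
  /-- `isSccRoot(s)` returns `false`. -/
  | notRoot (s : State α) (ps : List (State α)) (g : Store α) (h : g.low s ≠ g.index s) :
      Step φ X Y ⟨.exit s, ps, g⟩ 1 ⟨.return s, ps, g⟩
  /-- `isSccRoot(s)` returns `true`, `getScc()` pops the component of `s` from Tarjan's stack, and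
  `backwardSearch` is called on it. -/
  | root (s : State α) (ps : List (State α)) (g : Store α) (h : g.low s = g.index s)
      (C rest : List (State α)) (hC : s ∉ C) (hstack : g.stack = C ++ s :: rest) :
      Step φ X Y ⟨.exit s, ps, g⟩ ((s :: C).length + 1)
        ⟨.backward s (s :: C) (g.swin ∩ {v | v ∈ s :: C}), ps, { g with stack := rest }⟩
  /-- Head of the do-while loop of `backwardSearch(C)`: the candidates are computed. -/
  | round (s : State α) (C : List (State α)) (cur : Set (State α)) (ps : List (State α))
      (g : Store α) :
      Step φ X Y ⟨.backward s C cur, ps, g⟩ (C.length * 2 ^ (X ∪ Y).card + 1)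
        ⟨.candidates s C (directPredecessors X Y cur C ∩ g.undet) ∅, ps, g⟩
  /-- A candidate is found to be system-winning. -/
  | candYes (s : State α) (C : List (State α)) (cand new : Set (State α)) (ps : List (State α))
      (g : Store α) (v : State α) (hv : v ∈ cand) (h : SysWinning X Y g v) :
      Step φ X Y ⟨.candidates s C cand new, ps, g⟩ (2 ^ (X ∪ Y).card + 1)
        ⟨.candidates s C (cand \ {v}) (insert v new), ps, (g.recordSwin X Y v).markSwin v⟩
  /-- A candidate is not found to be system-winning. -/
  | candNo (s : State α) (C : List (State α)) (cand new : Set (State α)) (ps : List (State α))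
      (g : Store α) (v : State α) (hv : v ∈ cand) (h : ¬ SysWinning X Y g v) :
      Step φ X Y ⟨.candidates s C cand new, ps, g⟩ (2 ^ (X ∪ Y).card + 1)
        ⟨.candidates s C (cand \ {v}) new, ps, g.recordSwin X Y v⟩
  /-- All candidates are checked, and `new_swin` is not empty: next round. -/
  | nextRound (s : State α) (C : List (State α)) (new : Set (State α)) (ps : List (State α))
      (g : Store α) (h : new.Nonempty) :
      Step φ X Y ⟨.candidates s C ∅ new, ps, g⟩ (C.length + 1)
        ⟨.backward s C new, ps, { g with swin := g.swin ∪ new, undet := g.undet \ new }⟩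
  /-- All candidates are checked, and `new_swin` is empty: the rest of `C` is environment-winning. -/
  | lastRound (s : State α) (C : List (State α)) (ps : List (State α)) (g : Store α) :
      Step φ X Y ⟨.candidates s C ∅ ∅, ps, g⟩ (C.length + 1)
        ⟨.return s, ps,
          { g with ewin := g.ewin ∪ ({v | v ∈ C} \ g.swin), undet := g.undet \ {v | v ∈ C} }⟩
  /-- `forwardSearch(s)` returns to its caller `forwardSearch(p)`. -/
  | back (s p : State α) (ps : List (State α)) (g : Store α) :
      Step φ X Y ⟨.return s, p :: ps, g⟩ 1 ⟨.loop p, ps, g.lower p (g.low s)⟩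
  /-- The outermost call has returned, and the initial state is known to be system-winning. -/
  | yes (s : State α) (g : Store α) (h : cls φ ∈ g.swin) :
      Step φ X Y ⟨.return s, [], g⟩ 1 ⟨.halt .realizable, [], g⟩
  /-- The outermost call has returned, and the initial state is not known to be system-winning. -/
  | no (s : State α) (g : Store α) (h : cls φ ∉ g.swin) :
      Step φ X Y ⟨.return s, [], g⟩ 1 ⟨.halt .unrealizable, [], g⟩

/-- `Exec φ X Y t c`: some (partial) execution of the algorithm on `(φ, X, Y)` leads from the
initial configuration to `c`, and takes time `t`. -/
inductive Exec {α : Type u} [DecidableEq α] (φ : LTLf α) (X Y : Finset α) :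
    ℕ → Config α → Prop
  | start : Exec φ X Y 0 (init φ)
  | step {t k : ℕ} {c c' : Config α} (h : Exec φ X Y t c) (h' : Step φ X Y c k c') :
      Exec φ X Y (t + k) c'

/-- The algorithm on `(φ, X, Y)` terminates within time `T`: no execution takes more time than `T`
(every step takes time at least one, so there is no infinite execution), and an execution that
cannot be continued has returned an answer. -/
def TerminatesWithin {α : Type u} [DecidableEq α] (φ : LTLf α) (X Y : Finset α) (T : ℕ) : Prop :=
  ∀ (t : ℕ) (c : Config α), Exec φ X Y t c →
    t ≤ T ∧ ((∃ v, c.control = .halt v) ∨ ∃ k c', Step φ X Y c k c')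

/-- Some execution of the algorithm on `(φ, X, Y)` returns `v`. -/
def Returns {α : Type u} [DecidableEq α] (φ : LTLf α) (X Y : Finset α) (v : Verdict) : Prop :=
  ∃ (t : ℕ) (c : Config α), Exec φ X Y t c ∧ c.control = .halt v

end OnTheFly

/-! Synthesis is a reachability game on the propositional equivalence classes. By `sat_cons_iff`, a
trace with at least two letters satisfies a formula iff its tail satisfies the progression through
its first letter, so the system has to force an accepting transition of the automaton of classes.
`Win` is the least set closed under controllable predecessors; outside it the environment always has
a non-accepting response that stays outside. This gives `mooreRealizable_iff_win`.

Correctness is the invariant `Inv`, preserved by every step (`inv_step`). States in `swin` lie in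
`Win`; `ewin` is a trap, in which the environment can keep the play without ever allowing
acceptance, hence disjoint from `Win`. The only non-local classification is made at the end of a
backward search on a component C. When C is popped, its undetermined states are `Settled` and, by
the low-links, their recorded undetermined edges stay in C (`Good.pop`). The search maintains that
every undetermined state of C, up to candidates still to be tested, evades `swin` without its latest
additions. When a round adds nothing, the evading responses stay in C \ `swin`, which together with
`ewin` is a trap (`Pending.finish`). Only this closure property of C is used, not its strong
connectedness.

Time is bounded by the potential `fuel`. With N states in `closureStates` and E = 2^|X ∪ Y| edges
per state, each state is visited once and a component of m states costs O(m² E), so the total is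
O(N² E). Hence N itself must be about the square root of 2^2^n, where n = |tcl(φ)|. This holds
because formulas in negation normal form denote monotone functions of the n elements of the closure,
and the number of monotone functions is at most a d(n) with d(n + 1) = d(n)(d(n) + 1)/2, so that N²
≤ 4 · 2^2^n. -/

namespace LTLf

variable {α : Type u} [DecidableEq α]

/-! ### Progression, and realizability as a reachability game -/

/-- Progression removes the first letter of a trace of length at least two. -/
theorem sat_cons_iff (σ : Finset α) {ρ : List (Finset α)} (hρ : ρ ≠ []) (φ : LTLf α) :
    φ.Sat (σ :: ρ) ↔ (fp σ φ).Sat ρ := by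
  have hlen : 0 < ρ.length := List.length_pos_of_ne_nil hρ
  induction φ with
  | tt => exact Iff.rfl
  | ff => exact Iff.rfl
  | pos p => by_cases h : p ∈ σ <;> simp [Sat, fp, h]
  | neg p => by_cases h : p ∈ σ <;> simp [Sat, fp, h]
  | and φ ψ h₁ h₂ => exact and_congr h₁ h₂
  | or φ ψ h₁ h₂ => exact or_congr h₁ h₂
  | next φ _ => simp [Sat, fp, hlen]
  | wnext φ _ => simp [Sat, fp, hρ]
  | untl φ ψ h₁ h₂ =>
    simp only [fp, Sat, ← h₁, ← h₂]
    constructor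
    · rintro ⟨i, hi, h, h'⟩
      cases i with
      | zero => exact Or.inl h
      | succ i =>
        exact Or.inr ⟨h' 0 (Nat.succ_pos i), i, Nat.lt_of_succ_lt_succ hi, h,
          fun j hj => h' (j + 1) (Nat.succ_lt_succ hj)⟩
    · rintro (h | ⟨h, i, hi, h', h''⟩)
      · exact ⟨0, Nat.succ_pos _, h, fun j hj => absurd hj (Nat.not_lt_zero j)⟩
      · refine ⟨i + 1, Nat.succ_lt_succ hi, h', fun j hj => ?_⟩
        cases j with
        | zero => exact h
        | succ j => exact h'' j (Nat.lt_of_succ_lt_succ hj)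
  | rels φ ψ h₁ h₂ =>
    simp only [fp, Sat, ← h₁, ← h₂]
    constructor
    · rintro ⟨i, hi, h, h'⟩
      refine ⟨h' 0 (Nat.zero_le i), ?_⟩
      cases i with
      | zero =>
        -- At position 0 the end-of-trace alternative would leave an empty tail.
        refine Or.inl (h.resolve_left fun h => ?_)
        simp only [List.length_cons] at h
        omega
      | succ i =>
        exact Or.inr ⟨i, Nat.lt_of_succ_lt_succ hi, h.imp_left Nat.succ.inj,
          fun j hj => h' (j + 1) (Nat.succ_le_succ hj)⟩
    · rintro ⟨h, h' | ⟨i, hi, h', h''⟩⟩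
      · refine ⟨0, Nat.succ_pos _, Or.inr h', fun j hj => ?_⟩
        obtain rfl := Nat.le_zero.1 hj
        exact h
      · refine ⟨i + 1, Nat.succ_lt_succ hi, h'.imp_left (congrArg Nat.succ), fun j hj => ?_⟩
        cases j with
        | zero => exact h
        | succ j => exact h'' j (Nat.le_of_succ_le_succ hj)

/-- The states from which the system can force an accepting transition: the least set that is closed
under controllable predecessors. -/
inductive Win (X Y : Finset α) : State α → Prop
  | intro (s : State α) (y : Finset α) (hy : y ⊆ Y)
      (h : ∀ x ⊆ X, ¬ s.Acc (x ∪ y) → Win X Y (s.step (x ∪ y))) : Win X Y s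

/-- Induction over the least set `Win`: the environment's response inside T contradicts the
induction hypothesis. -/
theorem not_win_of_trap {X Y : Finset α} (T : Set (State α))
    (hT : ∀ s ∈ T, ∀ y ⊆ Y, ∃ x ⊆ X, ¬ s.Acc (x ∪ y) ∧ s.step (x ∪ y) ∈ T) {s : State α}
    (hs : s ∈ T) : ¬ Win X Y s := by
  intro h
  induction h with
  | intro s y hy _ ih =>
    obtain ⟨x, hx, h₁, h₂⟩ := hT s hs y hy
    exact ih x hx h₁ h₂

theorem exists_response_of_not_win {X Y : Finset α} {s : State α} (hs : ¬ Win X Y s) {y : Finset α}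
    (hy : y ⊆ Y) : ∃ x ⊆ X, ¬ s.Acc (x ∪ y) ∧ ¬ Win X Y (s.step (x ∪ y)) := by
  by_contra! h
  exact hs ⟨s, y, hy, h⟩

/-- Strategies are glued along the induction: play y first, then, after an environment choice x
without acceptance, the strategy that the induction hypothesis gives for the progression.
Quantifying over all formulas of the class lets it be applied to that progression. -/
theorem mooreRealizable_of_win {X Y : Finset α} {s : State α} (hs : Win X Y s) :
    ∀ φ : LTLf α, cls φ = s → φ.MooreRealizable X Y := by
  classical
  induction hs with
  | intro s y hy _ ih =>
    rintro φ rfl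
    have key : ∀ x : Finset α, ∃ g : List (Finset α) → Finset α, (∀ h, g h ⊆ Y) ∧
        (x ⊆ X → ¬ φ.Sat [x ∪ y] → ∀ z : ℕ → Finset α, (∀ i, z i ⊆ X) →
          ∃ k : ℕ, (fp (x ∪ y) φ).Sat
            ((List.range (k + 1)).map fun i => z i ∪ g ((List.range i).map z))) := by
      intro x
      by_cases h : x ⊆ X ∧ ¬ φ.Sat [x ∪ y]
      · obtain ⟨g, h₁, h₂⟩ := ih x h.1 h.2 (fp (x ∪ y) φ) rfl
        exact ⟨g, h₁, fun _ _ => h₂⟩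
      · exact ⟨fun _ => ∅, fun _ => Finset.empty_subset Y, fun h₁ h₂ => absurd ⟨h₁, h₂⟩ h⟩
    choose G hG hG' using key
    refine ⟨fun l => match l with
      | [] => y
      | x :: l => G x l, ?_, fun z hz => ?_⟩
    · rintro (_ | ⟨x, l⟩)
      · exact hy
      · exact hG x l
    · by_cases h : φ.Sat [z 0 ∪ y]
      · exact ⟨0, h⟩
      · obtain ⟨k, hk⟩ := hG' (z 0) (hz 0) h (fun i => z (i + 1)) fun i => hz (i + 1)
        refine ⟨k + 1, ?_⟩
        rw [List.range_succ_eq_map, List.map_cons, List.map_map]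
        refine (sat_cons_iff _ (by simp) φ).2 ?_
        convert hk using 4 with i
        · rfl
        · simp only [Function.comp, Nat.succ_eq_add_one]
          rw [List.range_succ_eq_map, List.map_cons, List.map_map]
          rfl

/-- Satisfaction by a trace is acceptance of the last letter after iterated progression. -/
theorem sat_append_singleton_iff (ρ : List (Finset α)) (σ : Finset α) (φ : LTLf α) :
    φ.Sat (ρ ++ [σ]) ↔ (ρ.foldl (fun ψ τ => fp τ ψ) φ).Sat [σ] := by
  induction ρ generalizing φ with
  | nil => exact Iff.rfl
  | cons τ ρ ih =>
    rw [List.cons_append, sat_cons_iff τ (by simp) φ]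
    exact ih (fp τ φ)

/-- If the initial class is not in `Win`, the environment answers the given strategy g by staying
outside `Win` forever, and no prefix of the resulting play is accepted. -/
theorem win_of_mooreRealizable {X Y : Finset α} {φ : LTLf α} (h : φ.MooreRealizable X Y) :
    Win X Y (cls φ) := by
  classical
  obtain ⟨g, hg, hg'⟩ := h
  by_contra hφ
  have key : ∀ (ψ : LTLf α) (l : List (Finset α)), ∃ x ⊆ X, ¬ Win X Y (cls ψ) →
      ¬ ψ.Sat [x ∪ g l] ∧ ¬ Win X Y (cls (fp (x ∪ g l) ψ)) := by
    intro ψ l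
    by_cases hψ : Win X Y (cls ψ)
    · exact ⟨∅, Finset.empty_subset X, fun h => absurd hψ h⟩
    · obtain ⟨x, hx, h₁, h₂⟩ := exists_response_of_not_win hψ (hg l)
      exact ⟨x, hx, fun _ => ⟨h₁, h₂⟩⟩
  choose r hr hr' using key
  -- `S n` is the formula progressed through the first n letters of the play, paired with the first
  -- n environment choices; `z` is the sequence of these choices.
  let S : ℕ → LTLf α × List (Finset α) := fun n => Nat.rec (φ, [])
    (fun _ p => (fp (r p.1 p.2 ∪ g p.2) p.1, p.2 ++ [r p.1 p.2])) n
  let z : ℕ → Finset α := fun n => r (S n).1 (S n).2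
  have hS : ∀ n, (S n).2 = (List.range n).map z := by
    intro n
    induction n with
    | zero => rfl
    | succ n ih =>
      rw [List.range_succ, List.map_append, ← ih]
      rfl
  have hS' : ∀ n, (S n).1 = ((List.range n).map fun i => z i ∪ g ((List.range i).map z)).foldl
      (fun ψ τ => fp τ ψ) φ := by
    intro n
    induction n with
    | zero => rfl
    | succ n ih =>
      rw [List.range_succ, List.map_append, List.foldl_append, ← ih]
      simp only [List.map_cons, List.map_nil, ← hS]
      rfl
  have hW : ∀ n, ¬ Win X Y (cls (S n).1) := by
    intro n
    induction n with
    | zero => exact hφ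
    | succ n ih => exact (hr' _ _ ih).2
  obtain ⟨k, hk⟩ := hg' z fun i => hr _ _
  rw [List.range_succ, List.map_append, List.map_singleton, sat_append_singleton_iff, ← hS',
    ← hS] at hk
  exact (hr' _ _ (hW k)).1 hk

theorem mooreRealizable_iff_win (φ : LTLf α) (X Y : Finset α) :
    φ.MooreRealizable X Y ↔ Win X Y (cls φ) :=
  ⟨win_of_mooreRealizable, fun h => mooreRealizable_of_win h φ rfl⟩

end LTLf

/-! ### Monotone predicates on sets with finite support -/

/-- The monotone predicates on sets that depend only on the intersection with `S`. -/
def monotonePreds {β : Type u} (S : Set β) : Set (Set β → Prop) :=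
  {P | Monotone P ∧ ∀ I, P I ↔ P (I ∩ S)}

/-- An upper bound of the Dedekind numbers. -/
def dedekindBound : ℕ → ℕ
  | 0 => 2
  | n + 1 => (dedekindBound n + 1).choose 2

/-- By antisymmetry a comparable ordered pair is determined by its unordered pair, and there are (n
+ 1 choose 2) unordered pairs with repetition. -/
theorem encard_le_pairs {β : Type u} [PartialOrder β] {T : Set β} {n : ℕ}
    (hT : T.encard ≤ n) :
    {p : β × β | p.1 ∈ T ∧ p.2 ∈ T ∧ p.1 ≤ p.2}.encard ≤ ((n + 1).choose 2 : ℕ) := by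
  classical
  obtain ⟨F, rfl⟩ := (Set.finite_of_encard_le_coe hT).exists_finset_coe
  rw [Set.encard_coe_eq_coe_finsetCard] at hT
  have hT' : F.card ≤ n := by exact_mod_cast hT
  calc {p : β × β | p.1 ∈ (F : Set β) ∧ p.2 ∈ (F : Set β) ∧ p.1 ≤ p.2}.encard
      ≤ (F.sym2 : Set (Sym2 β)).encard := by
        refine Set.encard_le_encard_of_injOn (f := fun p => s(p.1, p.2)) ?_ ?_
        · rintro ⟨a, b⟩ ⟨ha, hb, _⟩
          exact Finset.mk_mem_sym2_iff.2 ⟨ha, hb⟩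
        · rintro ⟨a, b⟩ ⟨_, _, hab⟩ ⟨c, d⟩ ⟨_, _, hcd⟩ h
          rcases Sym2.eq_iff.1 h with ⟨rfl, rfl⟩ | ⟨rfl, rfl⟩
          · rfl
          · exact Prod.ext (le_antisymm hab hcd) (le_antisymm hcd hab)
    _ = (F.sym2.card : ℕ) := Set.encard_coe_eq_coe_finsetCard _
    _ ≤ _ := by
        rw [Finset.card_sym2]
        exact_mod_cast Nat.choose_le_choose 2 (Nat.succ_le_succ hT')

/-- Fixing the membership of a new element a splits a monotone predicate into two monotone
predicates supported on S, the one without a implying the one with a. This comparable pair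
determines the predicate, whence the recursion of `dedekindBound`. -/
theorem encard_monotonePreds_le {β : Type u} [DecidableEq β] (S : Finset β) :
    (monotonePreds (S : Set β)).encard ≤ dedekindBound S.card := by
  induction S using Finset.induction_on with
  | empty =>
    calc (monotonePreds ((∅ : Finset β) : Set β)).encard ≤ (Set.univ : Set Prop).encard := by
          refine Set.encard_le_encard_of_injOn (f := fun P => P ∅) (fun _ _ => trivial) ?_
          rintro P ⟨_, hP⟩ Q ⟨_, hQ⟩ h
          have h' : P ∅ = Q ∅ := h
          funext I
          have h₁ := hP I
          have h₂ := hQ I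
          simp only [Finset.coe_empty, Set.inter_empty] at h₁ h₂
          exact propext (h₁.trans ((iff_of_eq h').trans h₂.symm))
      _ ≤ _ := by simp [dedekindBound, Set.encard_univ]
  | insert a S ha ih =>
    rw [Finset.card_insert_of_notMem ha]
    refine le_trans ?_ (encard_le_pairs ih)
    refine Set.encard_le_encard_of_injOn
      (f := fun P => (fun I => P (I \ {a}), fun I => P (insert a I))) ?_ ?_
    · rintro P ⟨hm, hP⟩
      refine ⟨⟨fun I J h => hm (Set.sdiff_subset_sdiff_left h), fun I => ?_⟩,
        ⟨fun I J h => hm (Set.insert_subset_insert h), fun I => ?_⟩,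
        fun I => hm (Set.sdiff_subset.trans (Set.subset_insert a I))⟩
      · change P _ ↔ P _
        rw [hP (I \ {a}), hP ((I ∩ S) \ {a})]
        apply iff_of_eq
        congr 1
        ext b
        simp only [Finset.coe_insert, Set.mem_inter_iff, Set.mem_sdiff, Set.mem_singleton_iff,
          Set.mem_insert_iff]
        tauto
      · change P _ ↔ P _
        rw [hP (insert a I), hP (insert a (I ∩ S))]
        apply iff_of_eq
        congr 1
        ext b
        simp only [Finset.coe_insert, Set.mem_inter_iff, Set.mem_insert_iff]
        tauto
    · rintro P ⟨_, hP⟩ Q ⟨_, hQ⟩ h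
      obtain ⟨h₁, h₂⟩ := Prod.ext_iff.1 h
      funext I
      by_cases hI : a ∈ I
      · have := congrFun h₂ I
        simpa [Set.insert_eq_of_mem hI] using this
      · have := congrFun h₁ I
        simpa [Set.sdiff_singleton_eq_self hI] using this

/-- Since d(d + 1)/2 ≤ d², the bound d(n)² ≤ 2^2^n passes from n to n + 1, the right side being
squared too. It holds at n = 4, where d = 231, but not earlier; the factor 4 covers n ≤ 3. -/
theorem dedekindBound_sq_le (n : ℕ) : dedekindBound n ^ 2 ≤ 4 * 2 ^ 2 ^ n := by
  have h4 : ∀ m, dedekindBound (m + 4) ^ 2 ≤ 2 ^ 2 ^ (m + 4) := by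
    intro m
    induction m with
    | zero => decide
    | succ m ih =>
      have h : dedekindBound (m + 1 + 4) ≤ dedekindBound (m + 4) ^ 2 := by
        change (dedekindBound (m + 4) + 1).choose 2 ≤ _
        rw [Nat.choose_two_right, Nat.add_sub_cancel]
        refine Nat.div_le_of_le_mul ?_
        nlinarith [Nat.le_self_pow two_ne_zero (dedekindBound (m + 4))]
      calc dedekindBound (m + 1 + 4) ^ 2 ≤ (dedekindBound (m + 4) ^ 2) ^ 2 :=
            Nat.pow_le_pow_left h 2
        _ ≤ (2 ^ 2 ^ (m + 4)) ^ 2 := Nat.pow_le_pow_left ih 2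
        _ = 2 ^ 2 ^ (m + 1 + 4) := by rw [← pow_mul, ← pow_succ, Nat.add_right_comm]
  match n with
  | 0 => decide
  | 1 => decide
  | 2 => decide
  | 3 => decide
  | m + 4 => exact (h4 m).trans (Nat.le_mul_of_pos_left _ (by norm_num))

/-! ### The reachable states -/

namespace LTLf

/-- Negation occurs only in literals, and p and ¬p count as independent variables. -/
theorem propSat_mono {α : Type u} (φ : LTLf α) : Monotone fun I => PropSat I φ := by
  intro I J h
  induction φ with
  | tt => exact id
  | ff => exact id
  | and φ ψ h₁ h₂ => exact And.imp h₁ h₂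
  | or φ ψ h₁ h₂ => exact Or.imp h₁ h₂
  | _ => exact fun hI => h hI

variable {α : Type u} [DecidableEq α]

theorem propSat_inter_iff {S : Set (LTLf α)} (φ : LTLf α) (hS : (φ.tcl : Set (LTLf α)) ⊆ S)
    (I : Set (LTLf α)) : PropSat I φ ↔ PropSat (I ∩ S) φ := by
  induction φ with
  | tt => exact Iff.rfl
  | ff => exact Iff.rfl
  | and φ ψ h₁ h₂ =>
    simp only [tcl, Finset.coe_union, Set.union_subset_iff] at hS
    exact and_congr (h₁ hS.1) (h₂ hS.2)
  | or φ ψ h₁ h₂ =>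
    simp only [tcl, Finset.coe_union, Set.union_subset_iff] at hS
    exact or_congr (h₁ hS.1) (h₂ hS.2)
  | _ => exact ⟨fun h => ⟨h, hS (by simp [tcl])⟩, And.left⟩

theorem tcl_fp_subset (σ : Finset α) (φ : LTLf α) : (fp σ φ).tcl ⊆ φ.tcl := by
  induction φ with
  | tt => exact subset_rfl
  | ff => exact subset_rfl
  | pos p => by_cases h : p ∈ σ <;> simp [fp, tcl, h]
  | neg p => by_cases h : p ∈ σ <;> simp [fp, tcl, h]
  | and φ ψ h₁ h₂ => exact Finset.union_subset_union h₁ h₂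
  | or φ ψ h₁ h₂ => exact Finset.union_subset_union h₁ h₂
  | next φ _ => exact Finset.subset_insert _ _
  | wnext φ _ => exact Finset.subset_insert _ _
  | untl φ ψ h₁ h₂ =>
    intro χ hχ
    simp only [fp, tcl, Finset.mem_union, Finset.mem_insert] at hχ ⊢
    have h₁' := @h₁ χ
    have h₂' := @h₂ χ
    tauto
  | rels φ ψ h₁ h₂ =>
    intro χ hχ
    simp only [fp, tcl, Finset.mem_union, Finset.mem_insert] at hχ ⊢
    have h₁' := @h₁ χ
    have h₂' := @h₂ χ
    tauto

/-- The classes of the Boolean combinations of the temporal closure of `φ`. -/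
def closureStates (φ : LTLf α) : Set (State α) := {s | ∃ ψ : LTLf α, ψ.tcl ⊆ φ.tcl ∧ cls ψ = s}

theorem cls_mem_closureStates (φ : LTLf α) : cls φ ∈ closureStates φ := ⟨φ, subset_rfl, rfl⟩

theorem step_mem_closureStates {φ : LTLf α} {s : State α} (hs : s ∈ closureStates φ)
    (σ : Finset α) : s.step σ ∈ closureStates φ := by
  obtain ⟨ψ, h, rfl⟩ := hs
  exact ⟨fp σ ψ, (tcl_fp_subset σ ψ).trans h, rfl⟩

/-- A class is determined by its truth function, which is monotone and depends only on the temporal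
closure of φ. -/
theorem encard_closureStates_le (φ : LTLf α) :
    (closureStates φ).encard ≤ dedekindBound φ.tcl.card := by
  refine le_trans ?_ (encard_monotonePreds_le φ.tcl)
  refine Set.encard_le_encard_of_injOn (f := fun s => fun I => PropSat I (Quotient.out s)) ?_ ?_
  · rintro _ ⟨ψ, h, rfl⟩
    refine ⟨propSat_mono _, fun I => ?_⟩
    have hout : ∀ I, PropSat I (Quotient.out (cls ψ)) ↔ PropSat I ψ :=
      Quotient.mk_out (s := propSetoid α) ψ
    simp only [hout]
    exact propSat_inter_iff ψ (Finset.coe_subset.2 h) I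
  · intro s _ t _ h
    rw [← Quotient.out_eq s, ← Quotient.out_eq t]
    exact Quotient.sound fun I => iff_of_eq (congrFun h I)

theorem finite_closureStates (φ : LTLf α) : (closureStates φ).Finite :=
  Set.finite_of_encard_le_coe (encard_closureStates_le φ)

theorem ncard_closureStates_sq_le (φ : LTLf α) :
    (closureStates φ).ncard ^ 2 ≤ 4 * 2 ^ 2 ^ φ.tcl.card := by
  refine le_trans (Nat.pow_le_pow_left ?_ 2) (dedekindBound_sq_le _)
  have h := encard_closureStates_le φ
  rw [← (finite_closureStates φ).cast_ncard_eq] at h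
  exact_mod_cast h

end LTLf

namespace OnTheFly

open LTLf

variable {α : Type u} [DecidableEq α]

/-! ### Invariants of the search -/

/-- The state `v` has been visited. -/
def Store.Known {α : Type u} (g : Store α) (v : State α) : Prop :=
  v ∈ g.undet ∨ v ∈ g.swin ∨ v ∈ g.ewin

/-- Whatever the system chooses at `v`, the environment has a non-accepting response that does not
lead into `T`. -/
def Evades (X Y : Finset α) (T : Set (State α)) (v : State α) : Prop :=
  ∀ y ⊆ Y, ∃ x ⊆ X, ¬ v.Acc (x ∪ y) ∧ v.step (x ∪ y) ∉ T

/-- Against the choice `y` at `v` the environment has a response that is known to be good. -/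
def EnvKnown (X : Finset α) (g : Store α) (v : State α) (y : Finset α) : Prop :=
  ∃ x ⊆ X, ¬ v.Acc (x ∪ y) ∧ (v.step (x ∪ y) = v ∨ v.step (x ∪ y) ∈ g.ewin)

/-- What is known about an undetermined state `v` whose forward search is over. -/
def Settled (X Y : Finset α) (g : Store α) (v : State α) : Prop :=
  ∀ y ⊆ Y, EnvKnown X g v y ∨
    (∀ x ⊆ X, v.Acc (x ∪ y) ∨ v.step (x ∪ y) ∈ g.swin ∨ (v, x ∪ y) ∈ g.undetT) ∧
      ∃ x ⊆ X, ¬ v.Acc (x ∪ y) ∧ (v, x ∪ y) ∈ g.undetT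

theorem Evades.mono {X Y : Finset α} {T T' : Set (State α)} {v : State α} (h : Evades X Y T v)
    (hT : T' ⊆ T) : Evades X Y T' v := fun y hy =>
  let ⟨x, hx, h₁, h₂⟩ := h y hy
  ⟨x, hx, h₁, fun h' => h₂ (hT h')⟩

theorem evades_of_not_sysWinning {X Y : Finset α} {g : Store α} {s : State α}
    (h : ¬ SysWinning X Y g s) : Evades X Y g.swin s := by
  intro y hy
  by_contra! h'
  exact h (Or.inr ⟨y, hy, fun x hx => or_iff_not_imp_left.2 (h' x hx)⟩)

/-- The classifications made so far are correct. -/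
structure Sound (X Y : Finset α) (g : Store α) : Prop where
  swin_win : ∀ s ∈ g.swin, Win X Y s
  ewin_trap : ∀ s ∈ g.ewin, ∀ y ⊆ Y, ∃ x ⊆ X, ¬ s.Acc (x ∪ y) ∧ s.step (x ∪ y) ∈ g.ewin
  swinT_spec : ∀ s e, (s, e) ∈ g.swinT → s.Acc e ∨ s.step e ∈ g.swin
  ewinT_spec : ∀ s e, (s, e) ∈ g.ewinT → ¬ s.Acc e ∧ (s.step e = s ∨ s.step e ∈ g.ewin)

namespace Sound

variable {X Y : Finset α} {g : Store α} {s : State α}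

theorem not_win (h : Sound X Y g) (hs : s ∈ g.ewin) : ¬ Win X Y s :=
  not_win_of_trap g.ewin h.ewin_trap hs

theorem not_mem_swin (h : Sound X Y g) (hs : s ∈ g.ewin) : s ∉ g.swin :=
  fun h' => h.not_win hs (h.swin_win s h')

theorem recordSwin (h : Sound X Y g) (s : State α) : Sound X Y (g.recordSwin X Y s) where
  swin_win := h.swin_win
  ewin_trap := h.ewin_trap
  swinT_spec := by
    rintro v e (he | ⟨rfl, x, -, y, -, rfl, h'⟩)
    · exact h.swinT_spec v e he
    · exact h'
  ewinT_spec := h.ewinT_spec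

theorem recordEwin (h : Sound X Y g) (s : State α) : Sound X Y (g.recordEwin X Y s) where
  swin_win := h.swin_win
  ewin_trap := h.ewin_trap
  swinT_spec := h.swinT_spec
  ewinT_spec := by
    rintro v e (he | ⟨rfl, x, -, y, -, rfl, h'⟩)
    · exact h.ewinT_spec v e he
    · exact h'

theorem markSwin (h : Sound X Y g) (hs : SysWinning X Y g s) : Sound X Y (g.markSwin s) where
  swin_win := by
    rintro v (rfl | hv)
    · rcases hs with hs | ⟨y, hy, hs⟩
      · exact h.swin_win v hs
      · exact ⟨v, y, hy, fun x hx hx' => h.swin_win _ ((hs x hx).resolve_left hx')⟩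
    · exact h.swin_win v hv
  ewin_trap := h.ewin_trap
  swinT_spec v e he := (h.swinT_spec v e he).imp_right Or.inr
  ewinT_spec := h.ewinT_spec

theorem markEwin (h : Sound X Y g) (hs : EnvWinning X Y g s) : Sound X Y (g.markEwin s) where
  swin_win := h.swin_win
  ewin_trap := by
    rintro v hv y hy
    by_cases hv' : v ∈ g.ewin
    · obtain ⟨x, hx, h₁, h₂⟩ := h.ewin_trap v hv' y hy
      exact ⟨x, hx, h₁, Or.inr h₂⟩
    · obtain rfl : v = s := hv.resolve_right hv'
      obtain ⟨x, hx, h₁, h₂⟩ := hs.resolve_left hv' y hy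
      exact ⟨x, hx, h₁, h₂⟩
  swinT_spec := h.swinT_spec
  ewinT_spec v e he := (h.ewinT_spec v e he).imp_right (Or.imp_right Or.inr)

end Sound

/-! ### Tarjan's algorithm: what the stack and the low-links guarantee -/

/-- `t` is on the stack, in the same part of it as `v` or below, as far as the states in `act` (whose
forward searches are active) can tell; and the latter case is recorded in a low-link. -/
structure Link {α : Type u} (act : List (State α)) (g : Store α) (v t : State α) : Prop where
  mem_stack : t ∈ g.stack
  not_between : ∀ a ∈ act, g.index a ≤ g.index v ∨ g.index t < g.index a
  low_le : ∃ a ∈ act, g.index a ≤ g.index v ∧ g.low a ≤ g.index t ∧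
    ∀ b ∈ act, g.index b ≤ g.index v → g.index b ≤ g.index a

/-- The invariant of Tarjan's algorithm; `act` are the active states, innermost first. -/
structure Tarjan (φ : LTLf α) (act : List (State α)) (g : Store α) : Prop where
  stack_sorted : g.stack.Pairwise fun a b => g.index b < g.index a
  index_lt : ∀ v ∈ g.stack, g.index v < g.counter
  act_sorted : act.Pairwise fun a b => g.index b < g.index a
  act_sub : ∀ a ∈ act, a ∈ g.stack
  low_le : ∀ a ∈ act, g.low a ≤ g.index a
  last : ∀ a, act.getLast? = some a → a = cls φ ∧ g.index a = 0
  link : ∀ v e, (v, e) ∈ g.undetT → v ∈ g.stack → Link act g v (v.step e)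

namespace Tarjan

variable {φ : LTLf α} {act ps : List (State α)} {g : Store α} {s p t : State α}

/-- The new index exceeds all those on the stack, so t separates no recorded edge between older
states and does not become the topmost active state below any of them; t itself has no recorded
edges. -/
theorem visit (h : Tarjan φ (s :: ps) g) (ht : t ∉ g.stack) (ht' : ∀ e, (t, e) ∉ g.undetT) :
    Tarjan φ (t :: s :: ps) (g.visit t) := by
  have hne : ∀ v ∈ g.stack, v ≠ t := fun v hv h' => ht (h' ▸ hv)
  have hi : ∀ v ∈ g.stack, (g.visit t).index v = g.index v := fun v hv => by
    simp [Store.visit, hne v hv]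
  have hl : ∀ v ∈ g.stack, (g.visit t).low v = g.low v := fun v hv => by
    simp [Store.visit, hne v hv]
  have hit : (g.visit t).index t = g.counter := by simp [Store.visit]
  have hlt : (g.visit t).low t = g.counter := by simp [Store.visit]
  have ha := h.act_sub
  constructor
  · refine List.pairwise_cons.2 ⟨fun v hv => ?_, h.stack_sorted.imp_of_mem fun hv hw h' => ?_⟩
    · rw [hit, hi v hv]
      exact h.index_lt v hv
    · rwa [hi _ hv, hi _ hw]
  · intro v hv
    change _ < g.counter + 1
    rcases List.mem_cons.1 hv with rfl | hv
    · rw [hit]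
      exact Nat.lt_succ_self _
    · rw [hi v hv]
      exact Nat.lt_succ_of_lt (h.index_lt v hv)
  · refine List.pairwise_cons.2 ⟨fun v hv => ?_, h.act_sorted.imp_of_mem fun hv hw h' => ?_⟩
    · rw [hit, hi v (ha v hv)]
      exact h.index_lt v (ha v hv)
    · rwa [hi _ (ha _ hv), hi _ (ha _ hw)]
  · intro a h'
    rcases List.mem_cons.1 h' with rfl | h'
    · exact List.mem_cons_self
    · exact List.mem_cons_of_mem _ (ha a h')
  · intro a h'
    rcases List.mem_cons.1 h' with rfl | h'
    · rw [hit, hlt]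
    · rw [hi a (ha a h'), hl a (ha a h')]
      exact h.low_le a h'
  · intro a h'
    rw [List.getLast?_cons_cons] at h'
    rw [hi a (ha a (List.mem_of_getLast? h'))]
    exact h.last a h'
  · intro v e he hv'
    rcases List.mem_cons.1 hv' with rfl | hv
    · exact absurd he (ht' e)
    · obtain ⟨h₁, h₂, a, h₃, h₄, h₅, h₆⟩ := h.link v e he hv
      refine ⟨List.mem_cons_of_mem _ h₁, fun b hb => ?_, a, List.mem_cons_of_mem _ h₃, ?_, ?_,
        fun b hb hbv => ?_⟩
      · rw [hi v hv, hi _ h₁]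
        rcases List.mem_cons.1 hb with rfl | hb
        · rw [hit]
          exact Or.inr (h.index_lt _ h₁)
        · rw [hi b (ha b hb)]
          exact h₂ b hb
      · rwa [hi a (ha a h₃), hi v hv]
      · rwa [hl a (ha a h₃), hi _ h₁]
      · rw [hi v hv] at hbv
        rw [hi a (ha a h₃)]
        rcases List.mem_cons.1 hb with rfl | hb
        · rw [hit] at hbv
          exact absurd (h.index_lt v hv) (Nat.not_lt.2 hbv)
        · rw [hi b (ha b hb)] at hbv ⊢
          exact h₆ b hb hbv

omit [DecidableEq α] in
theorem lower_low_le (g : Store α) (s : State α) (n : ℕ) (v : State α) :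
    (g.lower s n).low v ≤ g.low v := by
  classical
  change Function.update g.low s _ v ≤ _
  by_cases h : v = s
  · subst h
    rw [Function.update_self]
    exact min_le_left _ _
  · rw [Function.update_of_ne h]

omit [DecidableEq α] in
theorem lower_low_self_le (g : Store α) (s : State α) (n : ℕ) : (g.lower s n).low s ≤ n := by
  classical
  change Function.update g.low s _ s ≤ _
  rw [Function.update_self]
  exact min_le_right _ _

/-- Low-links are only bounded from above by the invariant, so any lowering preserves it. This also
covers lowering the caller by the low-link of a state already popped. -/
theorem lower (h : Tarjan φ act g) (p : State α) (n : ℕ) : Tarjan φ act (g.lower p n) where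
  stack_sorted := h.stack_sorted
  index_lt := h.index_lt
  act_sorted := h.act_sorted
  act_sub := h.act_sub
  low_le a ha := (lower_low_le g p n a).trans (h.low_le a ha)
  last := h.last
  link v e he hv := by
    obtain ⟨h₁, h₂, a, h₃, h₄, h₅, h₆⟩ := h.link v e he hv
    exact ⟨h₁, h₂, a, h₃, h₄, (lower_low_le g p n a).trans h₅, h₆⟩

theorem index_le_head (h : Tarjan φ (s :: ps) g) {a : State α} (ha : a ∈ s :: ps) :
    g.index a ≤ g.index s := by
  rcases List.mem_cons.1 ha with rfl | ha
  · exact le_rfl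
  · exact ((List.pairwise_cons.1 h.act_sorted).1 a ha).le

theorem undetEdge (h : Tarjan φ (s :: ps) g) {e : Finset α} (he : s.step e ∈ g.stack) :
    Tarjan φ (s :: ps)
      { g.lower s (g.index (s.step e)) with undetT := insert (s, e) g.undetT } where
  stack_sorted := h.stack_sorted
  index_lt := h.index_lt
  act_sorted := h.act_sorted
  act_sub := h.act_sub
  low_le a ha := (lower_low_le g s _ a).trans (h.low_le a ha)
  last := h.last
  link v f hf hv := by
    rcases hf with hf | hf
    · obtain ⟨rfl, rfl⟩ := Prod.ext_iff.1 hf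
      exact ⟨he, fun a ha => Or.inl (h.index_le_head ha), v, List.mem_cons_self, le_rfl,
        lower_low_self_le g v _, fun b _ hb => hb⟩
    · obtain ⟨h₁, h₂, a, h₃, h₄, h₅, h₆⟩ := h.link v f hf hv
      exact ⟨h₁, h₂, a, h₃, h₄, (lower_low_le g s _ a).trans h₅, h₆⟩

/-- When s ceases to be active, p takes over as the topmost active state for the links that s
witnessed; having inherited the low-link of s, it satisfies the same bound. -/
theorem back (h : Tarjan φ (s :: p :: ps) g) : Tarjan φ (p :: ps) (g.lower p (g.low s)) where
  stack_sorted := h.stack_sorted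
  index_lt := h.index_lt
  act_sorted := (List.pairwise_cons.1 h.act_sorted).2
  act_sub a ha := h.act_sub a (List.mem_cons_of_mem _ ha)
  low_le a ha := (lower_low_le g p _ a).trans (h.low_le a (List.mem_cons_of_mem _ ha))
  last a ha := h.last a (by rwa [List.getLast?_cons_cons])
  link v e he hv := by
    obtain ⟨h₁, h₂, a, h₃, h₄, h₅, h₆⟩ := h.link v e he hv
    refine ⟨h₁, fun b hb => h₂ b (List.mem_cons_of_mem _ hb), ?_⟩
    rcases List.mem_cons.1 h₃ with rfl | h₃
    · refine ⟨p, List.mem_cons_self, ?_, (lower_low_self_le g p _).trans h₅, fun b hb _ => ?_⟩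
      · exact (h.index_le_head (List.mem_cons_of_mem _ List.mem_cons_self)).trans h₄
      · rcases List.mem_cons.1 hb with rfl | hb
        · exact le_rfl
        · exact ((List.pairwise_cons.1 (List.pairwise_cons.1 h.act_sorted).2).1 b hb).le
    · exact ⟨a, h₃, h₄, (lower_low_le g p _ a).trans h₅,
        fun b hb => h₆ b (List.mem_cons_of_mem _ hb)⟩

section Pop

variable {C rest : List (State α)}

theorem index_lt_of_mem_component (h : Tarjan φ act g) (hC : g.stack = C ++ s :: rest)
    {v : State α} (hv : v ∈ C) : g.index s < g.index v := by
  have := h.stack_sorted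
  rw [hC] at this
  exact (List.pairwise_append.1 this).2.2 v hv s List.mem_cons_self

theorem index_lt_of_mem_rest (h : Tarjan φ act g) (hC : g.stack = C ++ s :: rest)
    {v : State α} (hv : v ∈ rest) : g.index v < g.index s := by
  have := h.stack_sorted
  rw [hC] at this
  exact (List.pairwise_cons.1 (List.pairwise_append.1 this).2.1).1 v hv

theorem mem_component_iff (h : Tarjan φ act g) (hC : g.stack = C ++ s :: rest)
    {v : State α} (hv : v ∈ g.stack) : v ∈ s :: C ↔ g.index s ≤ g.index v := by
  constructor
  · intro h'
    rcases List.mem_cons.1 h' with rfl | h'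
    · exact le_rfl
    · exact (h.index_lt_of_mem_component hC h').le
  · intro h'
    rw [hC] at hv
    rcases List.mem_append.1 hv with hv | hv
    · exact List.mem_cons_of_mem _ hv
    · rcases List.mem_cons.1 hv with rfl | hv
      · exact List.mem_cons_self
      · exact absurd (h.index_lt_of_mem_rest hC hv) (Nat.not_lt.2 h')

theorem mem_rest_iff (h : Tarjan φ act g) (hC : g.stack = C ++ s :: rest)
    {v : State α} (hv : v ∈ g.stack) : v ∈ rest ↔ g.index v < g.index s := by
  refine ⟨h.index_lt_of_mem_rest hC, fun h' => ?_⟩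
  have h'' := mt (h.mem_component_iff hC hv).1 (Nat.not_le.2 h')
  rw [hC] at hv
  simp only [List.mem_cons, List.mem_append] at hv h''
  tauto

/-- For v in the component, the topmost active state not above v is s, so the target has index at
least `low s = index s`. Being on the stack, it belongs to the component. -/
theorem mem_component_of_undetT (h : Tarjan φ (s :: ps) g) (hs : g.low s = g.index s)
    (hC : g.stack = C ++ s :: rest) {v : State α} (hv : v ∈ s :: C) {e : Finset α}
    (he : (v, e) ∈ g.undetT) : v.step e ∈ s :: C := by
  have hv' : v ∈ g.stack := by
    rw [hC]
    simp only [List.mem_cons, List.mem_append] at hv ⊢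
    tauto
  obtain ⟨h₁, h₂, a, h₃, h₄, h₅, h₆⟩ := h.link v e he hv'
  rw [h.mem_component_iff hC h₁]
  have h₇ := h₆ s List.mem_cons_self ((h.mem_component_iff hC hv').1 hv)
  rcases List.mem_cons.1 h₃ with rfl | h₃
  · exact hs ▸ h₅
  · exact absurd ((List.pairwise_cons.1 h.act_sorted).1 a h₃) (Nat.not_lt.2 h₇)

/-- Links from states below s survive: `not_between`, applied to s, puts their targets below s as
well, so no recorded edge left on the stack points into the popped component. -/
theorem pop (h : Tarjan φ (s :: ps) g) (hC : g.stack = C ++ s :: rest) :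
    Tarjan φ ps { g with stack := rest } := by
  have hsub : ∀ v ∈ rest, v ∈ g.stack := fun v hv => by
    rw [hC]
    exact List.mem_append_right _ (List.mem_cons_of_mem _ hv)
  have hps := List.pairwise_cons.1 h.act_sorted
  constructor
  · have := h.stack_sorted
    rw [hC] at this
    exact (List.pairwise_cons.1 (List.pairwise_append.1 this).2.1).2
  · exact fun v hv => h.index_lt v (hsub v hv)
  · exact hps.2
  · exact fun a ha => (h.mem_rest_iff hC (h.act_sub a (List.mem_cons_of_mem _ ha))).2 (hps.1 a ha)
  · exact fun a ha => h.low_le a (List.mem_cons_of_mem _ ha)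
  · intro a ha
    cases ps with
    | nil => simp at ha
    | cons p ps => exact h.last a (by rwa [List.getLast?_cons_cons])
  · intro v e he hv
    obtain ⟨h₁, h₂, a, h₃, h₄, h₅, h₆⟩ := h.link v e he (hsub v hv)
    have hvs := h.index_lt_of_mem_rest hC hv
    refine ⟨(h.mem_rest_iff hC h₁).2 ?_, fun b hb => h₂ b (List.mem_cons_of_mem _ hb), a, ?_, h₄,
      h₅, fun b hb => h₆ b (List.mem_cons_of_mem _ hb)⟩
    · exact (h₂ s List.mem_cons_self).resolve_left (Nat.not_le.2 hvs)
    · rcases List.mem_cons.1 h₃ with rfl | h₃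
      · exact absurd hvs (Nat.not_lt.2 h₄)
      · exact h₃

end Pop

end Tarjan
-- The global invariant, and its stability under classification
/-- The bookkeeping of the visited states; `pend` is a component that has been popped from the
stack, but is not yet fully classified. -/
structure Book (φ : LTLf α) (X Y : Finset α) (act pend : List (State α)) (g : Store α) :
    Prop where
  undetT_known : ∀ v e, (v, e) ∈ g.undetT → g.Known v
  undet_sub : ∀ v ∈ g.undet, v ∈ g.stack ∨ v ∈ pend
  stack_known : ∀ v ∈ g.stack, g.Known v
  known_reach : ∀ v, g.Known v → v ∈ closureStates φ
  settled : ∀ v ∈ g.stack, v ∉ act → v ∈ g.undet → Settled X Y g v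

/-- The invariant of the global variables. -/
structure Good (φ : LTLf α) (X Y : Finset α) (act pend : List (State α)) (g : Store α) :
    Prop where
  sound : Sound X Y g
  tarjan : Tarjan φ act g
  book : Book φ X Y act pend g

/-- From `g` to `g'`, visited states have been classified, and nothing else has happened to the
stack and the undetermined edges. -/
structure Reclassifies {α : Type u} (g g' : Store α) : Prop where
  index_eq : g'.index = g.index
  low_eq : g'.low = g.low
  counter_eq : g'.counter = g.counter
  stack_eq : g'.stack = g.stack
  undetT_eq : g'.undetT = g.undetT
  swin_sub : g.swin ⊆ g'.swin
  ewin_sub : g.ewin ⊆ g'.ewin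
  undet_sub : g'.undet ⊆ g.undet
  known_iff : ∀ v, g'.Known v ↔ g.Known v

section Reclassify

variable {φ : LTLf α} {X Y : Finset α} {act pend : List (State α)} {g g' g'' : Store α}
  {s v : State α}

omit [DecidableEq α] in
theorem Reclassifies.trans (h : Reclassifies g g') (h' : Reclassifies g' g'') :
    Reclassifies g g'' where
  index_eq := h'.index_eq.trans h.index_eq
  low_eq := h'.low_eq.trans h.low_eq
  counter_eq := h'.counter_eq.trans h.counter_eq
  stack_eq := h'.stack_eq.trans h.stack_eq
  undetT_eq := h'.undetT_eq.trans h.undetT_eq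
  swin_sub := h.swin_sub.trans h'.swin_sub
  ewin_sub := h.ewin_sub.trans h'.ewin_sub
  undet_sub := h'.undet_sub.trans h.undet_sub
  known_iff v := (h'.known_iff v).trans (h.known_iff v)

theorem reclassifies_recordSwin (X Y : Finset α) (g : Store α) (s : State α) :
    Reclassifies g (g.recordSwin X Y s) :=
  ⟨rfl, rfl, rfl, rfl, rfl, subset_rfl, subset_rfl, subset_rfl, fun _ => Iff.rfl⟩

theorem reclassifies_recordEwin (X Y : Finset α) (g : Store α) (s : State α) :
    Reclassifies g (g.recordEwin X Y s) :=
  ⟨rfl, rfl, rfl, rfl, rfl, subset_rfl, subset_rfl, subset_rfl, fun _ => Iff.rfl⟩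

omit [DecidableEq α] in
theorem reclassifies_markSwin (h : g.Known s) : Reclassifies g (g.markSwin s) := by
  refine ⟨rfl, rfl, rfl, rfl, rfl, Set.subset_insert _ _, subset_rfl, Set.sdiff_subset, ?_⟩
  intro v
  by_cases hv : v = s
  · subst hv
    exact iff_of_true (Or.inr (Or.inl (Set.mem_insert v g.swin))) h
  · simp [Store.Known, Store.markSwin, hv]

omit [DecidableEq α] in
theorem reclassifies_markEwin (h : g.Known s) : Reclassifies g (g.markEwin s) := by
  refine ⟨rfl, rfl, rfl, rfl, rfl, subset_rfl, Set.subset_insert _ _, Set.sdiff_subset, ?_⟩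
  intro v
  by_cases hv : v = s
  · subst hv
    exact iff_of_true (Or.inr (Or.inr (Set.mem_insert v g.ewin))) h
  · simp [Store.Known, Store.markEwin, hv]

theorem EnvKnown.mono {y : Finset α} (h : EnvKnown X g v y) (hg : g.ewin ⊆ g'.ewin) :
    EnvKnown X g' v y :=
  let ⟨x, hx, h₁, h₂⟩ := h
  ⟨x, hx, h₁, h₂.imp_right fun h' => hg h'⟩

theorem Settled.mono (h : Settled X Y g v) (h₁ : g.swin ⊆ g'.swin) (h₂ : g.ewin ⊆ g'.ewin)
    (h₃ : g.undetT ⊆ g'.undetT) : Settled X Y g' v := fun y hy =>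
  (h y hy).imp (fun h' => h'.mono h₂) fun h' =>
    ⟨fun x hx => (h'.1 x hx).imp_right (Or.imp (fun h => h₁ h) fun h => h₃ h),
      let ⟨x, hx, h₄, h₅⟩ := h'.2
      ⟨x, hx, h₄, h₃ h₅⟩⟩

theorem Tarjan.congr (h : Tarjan φ act g) (h₁ : g'.index = g.index) (h₂ : g'.low = g.low)
    (h₃ : g'.counter = g.counter) (h₄ : g'.stack = g.stack) (h₅ : g'.undetT = g.undetT) :
    Tarjan φ act g' := by
  obtain ⟨a, b, c, d, e, f, l⟩ := h
  refine ⟨?_, ?_, ?_, ?_, ?_, ?_, fun v x => ?_⟩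
  · rwa [h₁, h₄]
  · rwa [h₁, h₃, h₄]
  · rwa [h₁]
  · rwa [h₄]
  · rwa [h₁, h₂]
  · rwa [h₁]
  · rw [h₄, h₅]
    intro h₆ h₇
    obtain ⟨i, j, k⟩ := l v x h₆ h₇
    refine ⟨?_, ?_, ?_⟩
    · rwa [h₄]
    · rwa [h₁]
    · rwa [h₁, h₂]

theorem Book.reclassify (h : Book φ X Y act pend g) (h' : Reclassifies g g') :
    Book φ X Y act pend g' where
  undetT_known v e he := (h'.known_iff v).2 (h.undetT_known v e (h'.undetT_eq ▸ he))
  undet_sub v hv := by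
    rw [h'.stack_eq]
    exact h.undet_sub v (h'.undet_sub hv)
  stack_known v hv := (h'.known_iff v).2 (h.stack_known v (h'.stack_eq ▸ hv))
  known_reach v hv := h.known_reach v ((h'.known_iff v).1 hv)
  settled v hv hv' hv'' :=
    (h.settled v (h'.stack_eq ▸ hv) hv' (h'.undet_sub hv'')).mono h'.swin_sub h'.ewin_sub
      h'.undetT_eq.ge

theorem Good.reclassify (h : Good φ X Y act pend g) (h' : Reclassifies g g') (hs : Sound X Y g') :
    Good φ X Y act pend g' :=
  ⟨hs, h.tarjan.congr h'.index_eq h'.low_eq h'.counter_eq h'.stack_eq h'.undetT_eq,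
    h.book.reclassify h'⟩

end Reclassify

/-! ### Forward exploration, popped components and the invariant of the machine -/

/-- The component `C` has been popped, and is not yet fully classified. -/
structure Pending (φ : LTLf α) (X Y : Finset α) (ps C : List (State α)) (g : Store α) :
    Prop where
  good : Good φ X Y ps C g
  known : ∀ v ∈ C, g.Known v
  closed : ∀ v ∈ C, v ∈ g.undet → ∀ y ⊆ Y, EnvKnown X g v y ∨
    ∀ x ⊆ X, v.Acc (x ∪ y) ∨ v.step (x ∪ y) ∈ g.swin ∨ v.step (x ∪ y) ∈ C
  initial_mem : ps = [] → cls φ ∈ C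
  length_le : C.length ≤ (closureStates φ).ncard

theorem Pending.reclassify {φ : LTLf α} {X Y : Finset α} {ps C : List (State α)} {g g' : Store α}
    (h : Pending φ X Y ps C g) (h' : Reclassifies g g') (hs : Sound X Y g') :
    Pending φ X Y ps C g' where
  good := h.good.reclassify h' hs
  known v hv := (h'.known_iff v).2 (h.known v hv)
  closed v hv hv' y hy := (h.closed v hv (h'.undet_sub hv') y hy).imp
    (fun h'' => h''.mono h'.ewin_sub)
    fun h'' x hx => (h'' x hx).imp_right (Or.imp_left fun h''' => h'.swin_sub h''')
  initial_mem := h.initial_mem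
  length_le := h.length_le

/-- The edges in `W` are still to be explored at `s`, and the status of `s` is unknown. -/
structure Exploring (X Y : Finset α) (g : Store α) (s : State α) (W : Set (Finset α)) : Prop where
  sub : W ⊆ ((X ∪ Y).powerset : Set (Finset α))
  fresh : ∀ e ∈ W, s.step e ∉ g.swin ∧ s.step e ∉ g.ewin
  progress : ∀ y ⊆ Y, EnvKnown X g s y ∨
    (∀ x ⊆ X, s.Acc (x ∪ y) ∨ s.step (x ∪ y) ∈ g.swin ∨ (s, x ∪ y) ∈ g.undetT ∨ x ∪ y ∈ W) ∧
      ∃ x ⊆ X, ¬ s.Acc (x ∪ y) ∧ s.step (x ∪ y) ∉ g.swin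

/-- The invariant of the algorithm. -/
def Inv (φ : LTLf α) (X Y : Finset α) : Config α → Prop
  | ⟨.loop s, ps, g⟩ => Good φ X Y (s :: ps) [] g
  | ⟨.explore s W, ps, g⟩ => Good φ X Y (s :: ps) [] g ∧ Exploring X Y g s W
  | ⟨.exit s, ps, g⟩ => Good φ X Y (s :: ps) [] g ∧ (s ∈ g.undet → Settled X Y g s)
  | ⟨.backward _ C cur, ps, g⟩ => Pending φ X Y ps C g ∧
      ∀ v ∈ C, v ∈ g.undet → Evades X Y (g.swin \ cur) v
  | ⟨.candidates _ C cand new, ps, g⟩ => Pending φ X Y ps C g ∧ new ⊆ g.swin ∧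
      cand ⊆ {v | v ∈ C} ∩ g.undet ∧
      ∀ v ∈ C, v ∈ g.undet → v ∈ cand ∨ Evades X Y (g.swin \ new) v
  | ⟨.return s, ps, g⟩ =>
      (Good φ X Y (s :: ps) [] g ∧ (s ∈ g.undet → Settled X Y g s) ∧ ps ≠ []) ∨
        (Good φ X Y ps [] g ∧ (ps = [] → cls φ ∈ g.swin ∨ cls φ ∈ g.ewin))
  | ⟨.halt .realizable, _, _⟩ => Win X Y (cls φ)
  | ⟨.halt .unrealizable, _, _⟩ => ¬ Win X Y (cls φ)

section Steps

variable {φ : LTLf α} {X Y : Finset α} {ps : List (State α)} {g : Store α} {s : State α}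

theorem Good.known_head {pend : List (State α)} (h : Good φ X Y (s :: ps) pend g) : g.Known s :=
  h.book.stack_known s (h.tarjan.act_sub s List.mem_cons_self)

theorem Good.visit (h : Good φ X Y (s :: ps) [] g) {t : State α} (ht : ¬ g.Known t)
    (ht' : t ∈ closureStates φ) : Good φ X Y (t :: s :: ps) [] (g.visit t) where
  sound := ⟨h.sound.1, h.sound.2, h.sound.3, h.sound.4⟩
  tarjan := h.tarjan.visit (fun h' => ht (h.book.stack_known t h'))
    fun e he => ht (h.book.undetT_known t e he)
  book :=
    { undetT_known := fun v e he => (h.book.undetT_known v e he).imp_left Or.inr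
      undet_sub := by
        rintro v (rfl | hv)
        · exact Or.inl List.mem_cons_self
        · exact (h.book.undet_sub v hv).imp_left (List.mem_cons_of_mem _)
      stack_known := by
        intro v hv
        rcases List.mem_cons.1 hv with rfl | hv
        · exact Or.inl (Set.mem_insert v g.undet)
        · exact (h.book.stack_known v hv).imp_left Or.inr
      known_reach := by
        rintro v ((rfl | hv) | hv)
        · exact ht'
        · exact h.book.known_reach v (Or.inl hv)
        · exact h.book.known_reach v (Or.inr hv)
      settled := by
        intro v hv hv' hv''
        simp only [List.mem_cons, not_or] at hv'
        refine (h.book.settled v ((List.mem_cons.1 hv).resolve_left hv'.1) ?_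
          (hv''.resolve_left hv'.1)).mono subset_rfl subset_rfl subset_rfl
        simpa using hv'.2 }

/-- The two tests have just recorded every edge of s that is decided by the present classification.
Hence an open edge leads to no classified state, and a recursive call always visits a new state. -/
theorem exploring_of_unknown (h : Sound X Y g) (h₁ : ¬ SysWinning X Y g s) :
    Exploring X Y ((g.recordSwin X Y s).recordEwin X Y s) s
      (openEdges X Y ((g.recordSwin X Y s).recordEwin X Y s) s) where
  sub := by
    rintro _ ⟨x, hx, y, hy, rfl, -⟩
    exact Finset.mem_coe.2 (Finset.mem_powerset.2 (Finset.union_subset_union hx hy))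
  fresh := by
    rintro _ ⟨x, hx, y, hy, rfl, h₂, h₃, -⟩
    refine ⟨fun h' => h₃ ⟨hx, Or.inr ⟨rfl, x, hx, y, hy, rfl, Or.inr h'⟩⟩, fun h' => h₂ ?_⟩
    refine ⟨hy, x, hx, Or.inr ⟨rfl, x, hx, y, hy, rfl, fun h'' => ?_, Or.inr h'⟩⟩
    exact h₃ ⟨hx, Or.inr ⟨rfl, x, hx, y, hy, rfl, Or.inl h''⟩⟩
  progress := by
    intro y hy
    by_cases hy' : y ∈ knownEwin X Y ((g.recordSwin X Y s).recordEwin X Y s) s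
    · obtain ⟨-, x, hx, h'⟩ := hy'
      exact Or.inl ⟨x, hx, ((h.recordSwin s).recordEwin s).ewinT_spec s _ h'⟩
    · refine Or.inr ⟨fun x hx => ?_, evades_of_not_sysWinning h₁ y hy⟩
      by_cases hx' : x ∈ knownSwin X ((g.recordSwin X Y s).recordEwin X Y s) s y
      · rcases ((h.recordSwin s).recordEwin s).swinT_spec s _ hx'.2 with h' | h'
        · exact Or.inl h'
        · exact Or.inr (Or.inl h')
      by_cases hx'' : x ∈ knownUndet X ((g.recordSwin X Y s).recordEwin X Y s) s y
      · exact Or.inr (Or.inr (Or.inl hx''.2))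
      · exact Or.inr (Or.inr (Or.inr ⟨x, hx, y, hy, rfl, hy', hx', hx''⟩))

theorem Good.undetEdge (h : Good φ X Y (s :: ps) [] g) {e : Finset α} (he : s.step e ∈ g.undet) :
    Good φ X Y (s :: ps) []
      { g.lower s (g.index (s.step e)) with undetT := insert (s, e) g.undetT } where
  sound := ⟨h.sound.1, h.sound.2, h.sound.3, h.sound.4⟩
  tarjan := h.tarjan.undetEdge ((h.book.undet_sub _ he).resolve_right List.not_mem_nil)
  book :=
    { undetT_known := by
        rintro v f (hf | hf)
        · obtain ⟨rfl, rfl⟩ := Prod.ext_iff.1 hf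
          exact h.known_head
        · exact h.book.undetT_known v f hf
      undet_sub := h.book.undet_sub
      stack_known := h.book.stack_known
      known_reach := h.book.known_reach
      settled := fun v h₁ h₂ h₃ => (h.book.settled v h₁ h₂ h₃).mono subset_rfl subset_rfl
        (Set.subset_insert _ _) }

theorem Exploring.undetEdge {W : Set (Finset α)} (h : Exploring X Y g s W) (e : Finset α) :
    Exploring X Y { g.lower s (g.index (s.step e)) with undetT := insert (s, e) g.undetT } s
      (W \ {e}) where
  sub := Set.sdiff_subset.trans h.sub
  fresh f hf := h.fresh f hf.1
  progress y hy := (h.progress y hy).imp_right fun ⟨h₁, h₂⟩ => by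
    refine ⟨fun x hx => ?_, h₂⟩
    by_cases hxe : x ∪ y = e
    · exact Or.inr (Or.inr (Or.inl (Or.inl (by rw [hxe]))))
    · exact (h₁ x hx).imp_right (Or.imp_right (Or.imp Or.inr fun h' => ⟨h', hxe⟩))

/-- With no open edge left, the non-accepting response that avoids `swin` must be a recorded
undetermined edge. -/
theorem Exploring.settled (h : Exploring X Y g s ∅) : Settled X Y g s := fun y hy =>
  (h.progress y hy).imp_right fun ⟨h₁, x, hx, h₂, h₃⟩ => by
    have h₁' : ∀ x ⊆ X, s.Acc (x ∪ y) ∨ s.step (x ∪ y) ∈ g.swin ∨ (s, x ∪ y) ∈ g.undetT :=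
      fun x hx => (h₁ x hx).imp_right (Or.imp_right (Or.resolve_right · (Set.notMem_empty _)))
    exact ⟨h₁', x, hx, h₂, ((h₁' x hx).resolve_left h₂).resolve_left h₃⟩

theorem Good.back {p : State α} (h : Good φ X Y (s :: p :: ps) [] g)
    (hs : s ∈ g.undet → Settled X Y g s) : Good φ X Y (p :: ps) [] (g.lower p (g.low s)) where
  sound := ⟨h.sound.1, h.sound.2, h.sound.3, h.sound.4⟩
  tarjan := h.tarjan.back
  book :=
    { undetT_known := h.book.undetT_known
      undet_sub := h.book.undet_sub
      stack_known := h.book.stack_known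
      known_reach := h.book.known_reach
      settled := by
        intro v h₁ h₂ h₃
        by_cases hv : v = s
        · subst hv
          exact hs h₃
        · exact h.book.settled v h₁ (fun h' => (List.mem_cons.1 h').elim hv h₂) h₃ }

theorem Good.lower {act : List (State α)} (h : Good φ X Y act [] g) (p : State α) (n : ℕ) :
    Good φ X Y act [] (g.lower p n) where
  sound := ⟨h.sound.1, h.sound.2, h.sound.3, h.sound.4⟩
  tarjan := h.tarjan.lower p n
  book := ⟨h.book.1, h.book.2, h.book.3, h.book.4, h.book.5⟩

theorem Good.stack_nodup {act pend : List (State α)} (h : Good φ X Y act pend g) :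
    g.stack.Nodup :=
  h.tarjan.stack_sorted.imp fun h' h'' => absurd h' (by rw [h'']; exact lt_irrefl _)

/-- The component contains no active state besides s, so all its undetermined states are settled.
Their known responses either stay in the component, by a self-loop or by a recorded undetermined
edge, or lead to `ewin`; they can meet `swin` only inside the component, which is why the backward
search may start from `swin ∩ C`. -/
theorem Good.pop (h : Good φ X Y (s :: ps) [] g) (hs : s ∈ g.undet → Settled X Y g s)
    (hroot : g.low s = g.index s) {C rest : List (State α)} (hstack : g.stack = C ++ s :: rest) :
    Pending φ X Y ps (s :: C) { g with stack := rest } ∧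
      ∀ v ∈ s :: C, v ∈ g.undet →
        Evades X Y (g.swin \ (g.swin ∩ {v | v ∈ s :: C})) v := by
  have hmem : ∀ v ∈ s :: C, v ∈ g.stack := fun v hv => by
    rw [hstack]
    simp only [List.mem_cons, List.mem_append] at hv ⊢
    tauto
  have hrest : ∀ v ∈ rest, v ∈ g.stack := fun v hv => by
    rw [hstack]
    exact List.mem_append_right _ (List.mem_cons_of_mem _ hv)
  have hset : ∀ v ∈ s :: C, v ∈ g.undet → Settled X Y g v := by
    intro v hv hv'
    by_cases hvs : v = s
    · subst hvs
      exact hs hv'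
    · refine h.book.settled v (hmem v hv) (fun h' => ?_) hv'
      have h₁ := (List.mem_cons.1 h').resolve_left hvs
      exact absurd ((List.pairwise_cons.1 h.tarjan.act_sorted).1 v h₁)
        (Nat.not_lt.2 ((h.tarjan.mem_component_iff hstack (hmem v hv)).1 hv))
  have hlink : ∀ v ∈ s :: C, ∀ e, (v, e) ∈ g.undetT → v.step e ∈ s :: C := fun v hv e he =>
    h.tarjan.mem_component_of_undetT hroot hstack hv he
  refine ⟨⟨⟨⟨h.sound.1, h.sound.2, h.sound.3, h.sound.4⟩, h.tarjan.pop hstack, ?_⟩,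
    fun v hv => h.book.stack_known v (hmem v hv), fun v hv hv' y hy => ?_, ?_, ?_⟩,
    fun v hv hv' y hy => ?_⟩
  · refine ⟨h.book.undetT_known, fun v hv => ?_, fun v hv => h.book.stack_known v (hrest v hv),
      h.book.known_reach, fun v hv hv' hv'' => ?_⟩
    · have h' := (h.book.undet_sub v hv).resolve_right List.not_mem_nil
      rw [hstack] at h'
      simp only [List.mem_cons, List.mem_append] at h' ⊢
      tauto
    · refine h.book.settled v (hrest v hv) (fun h' => ?_) hv''
      rcases List.mem_cons.1 h' with rfl | h'
      · exact absurd (h.tarjan.index_lt_of_mem_rest hstack hv) (lt_irrefl _)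
      · exact hv' h'
  · exact (hset v hv hv' y hy).imp_right fun h' x hx =>
      (h'.1 x hx).imp_right (Or.imp_right (hlink v hv _))
  · rintro rfl
    rw [(h.tarjan.last s rfl).1]
    exact List.mem_cons_self
  · classical
    have hnd : (s :: C).Nodup := by
      have h' := h.stack_nodup
      rw [hstack] at h'
      exact (List.nodup_append.1 ((List.perm_middle.nodup_iff).1 h' :
        (s :: C ++ rest).Nodup)).1
    rw [← List.toFinset_card_of_nodup hnd, ← Set.ncard_coe_finset]
    refine Set.ncard_le_ncard (fun v hv => ?_) (finite_closureStates φ)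
    exact h.book.known_reach v (h.book.stack_known v (hmem v (List.mem_toFinset.1 hv)))
  · rcases hset v hv hv' y hy with ⟨x, hx, h₁, h₂⟩ | ⟨-, x, hx, h₁, h₂⟩
    · refine ⟨x, hx, h₁, fun h₃ => ?_⟩
      rcases h₂ with h₂ | h₂
      · rw [h₂] at h₃
        exact h₃.2 ⟨h₃.1, hv⟩
      · exact h.sound.not_mem_swin h₂ h₃.1
    · exact ⟨x, hx, h₁, fun h₃ => h₃.2 ⟨h₃.1, hlink v hv _ h₂⟩⟩

theorem Pending.reclassifies_finish {C : List (State α)} (h : Pending φ X Y ps C g) :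
    Reclassifies g
      { g with ewin := g.ewin ∪ ({v | v ∈ C} \ g.swin), undet := g.undet \ {v | v ∈ C} } := by
  refine ⟨rfl, rfl, rfl, rfl, rfl, subset_rfl, Set.subset_union_left, Set.sdiff_subset, ?_⟩
  intro v
  have := h.known v
  simp only [Store.Known, Set.mem_sdiff, Set.mem_union, Set.mem_ofPred_eq] at this ⊢
  tauto

omit [DecidableEq α] in
theorem reclassifies_nextRound {new : Set (State α)} (h : new ⊆ g.swin) :
    Reclassifies g { g with swin := g.swin ∪ new, undet := g.undet \ new } := by
  refine ⟨rfl, rfl, rfl, rfl, rfl, Set.subset_union_left, subset_rfl, Set.sdiff_subset, ?_⟩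
  intro v
  have := @h v
  simp only [Store.Known, Set.mem_sdiff, Set.mem_union]
  tauto

/-- The enlarged `ewin` is a trap: unless a good response is already known, every response is
accepting or leads to `swin` or C, and the evading one is neither accepting nor leads to `swin`. -/
theorem Pending.finish {C : List (State α)} (h : Pending φ X Y ps C g)
    (hC : ∀ v ∈ C, v ∈ g.undet → Evades X Y g.swin v) :
    Good φ X Y ps []
      { g with ewin := g.ewin ∪ ({v | v ∈ C} \ g.swin), undet := g.undet \ {v | v ∈ C} } := by
  have hgood := h.good.reclassify h.reclassifies_finish ⟨h.good.sound.swin_win,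
    ?_, h.good.sound.swinT_spec, fun v e he => (h.good.sound.ewinT_spec v e he).imp_right (Or.imp_right Or.inl)⟩
  · refine ⟨hgood.sound, hgood.tarjan, hgood.book.1, fun v hv => ?_, hgood.book.3, hgood.book.4,
      hgood.book.5⟩
    exact Or.inl ((hgood.book.undet_sub v hv).resolve_right hv.2)
  · intro v hv y hy
    by_cases hv' : v ∈ g.ewin
    · obtain ⟨x, hx, h₁, h₂⟩ := h.good.sound.ewin_trap v hv' y hy
      exact ⟨x, hx, h₁, Or.inl h₂⟩
    · obtain ⟨hvC, hvs⟩ := hv.resolve_left hv'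
      have hvu : v ∈ g.undet := (h.known v hvC).resolve_right (not_or.2 ⟨hvs, hv'⟩)
      rcases h.closed v hvC hvu y hy with ⟨x, hx, h₁, h₂⟩ | h'
      · refine ⟨x, hx, h₁, ?_⟩
        rcases h₂ with h₂ | h₂
        · rw [h₂]
          exact hv
        · exact Or.inl h₂
      · obtain ⟨x, hx, h₁, h₂⟩ := hC v hvC hvu y hy
        exact ⟨x, hx, h₁, Or.inr ⟨((h' x hx).resolve_left h₁).resolve_left h₂, h₂⟩⟩

theorem good_init (φ : LTLf α) (X Y : Finset α) :
    Good φ X Y [cls φ] [] ((Store.empty α).visit (cls φ)) where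
  sound := by constructor <;> simp [Store.visit, Store.empty]
  tarjan := by constructor <;> simp [Store.visit, Store.empty]
  book := by
    constructor <;> simp [Store.visit, Store.empty, Store.Known]
    exact cls_mem_closureStates φ

end Steps

/-! ### Preservation of the invariant, and progress -/

theorem inv_step {φ : LTLf α} {X Y : Finset α} {c c' : Config α} {k : ℕ} (h : Inv φ X Y c)
    (h' : Step φ X Y c k c') : Inv φ X Y c' := by
  cases h' with
  | checkSys s ps g hs =>
    have h₀ : Good φ X Y (s :: ps) [] g := h
    have h₁ := h₀.reclassify (reclassifies_recordSwin X Y g s) (h₀.sound.recordSwin s)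
    exact ⟨h₁.reclassify (reclassifies_markSwin h₁.known_head) (h₁.sound.markSwin hs),
      fun hu => absurd rfl hu.2⟩
  | checkEnv s ps g _ he =>
    have h₀ : Good φ X Y (s :: ps) [] g := h
    have h₁ := h₀.reclassify (reclassifies_recordSwin X Y g s) (h₀.sound.recordSwin s)
    have h₂ := h₁.reclassify (reclassifies_recordEwin X Y _ s) (h₁.sound.recordEwin s)
    exact ⟨h₂.reclassify (reclassifies_markEwin h₂.known_head) (h₂.sound.markEwin he),
      fun hu => absurd rfl hu.2⟩
  | checkUnknown s ps g hs _ =>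
    have h₀ : Good φ X Y (s :: ps) [] g := h
    have h₁ := h₀.reclassify (reclassifies_recordSwin X Y g s) (h₀.sound.recordSwin s)
    exact ⟨h₁.reclassify (reclassifies_recordEwin X Y _ s) (h₁.sound.recordEwin s),
      exploring_of_unknown h₀.sound hs⟩
  | noEdge s ps g => exact ⟨h.1, fun _ => h.2.settled⟩
  | undetEdge s W ps g e he hu => exact ⟨h.1.undetEdge hu, h.2.undetEdge e⟩
  | call s W ps g e he hu =>
    have hf := h.2.fresh e he
    exact h.1.visit (not_or.2 ⟨hu, not_or.2 hf⟩)
      (step_mem_closureStates (h.1.book.known_reach s h.1.known_head) e)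
  | notRoot s ps g hr =>
    refine Or.inl ⟨h.1, h.2, ?_⟩
    rintro rfl
    -- The outermost state has index 0, so its low-link cannot be smaller and it passes the root
    -- test.
    have h₁ := (h.1.tarjan.last s rfl).2
    have h₂ := h.1.tarjan.low_le s List.mem_cons_self
    omega
  | root s ps g hr C rest _ hstack => exact h.1.pop h.2 hr hstack
  | round s C cur ps g =>
    refine ⟨h.1, Set.empty_subset _, fun v hv => ⟨hv.1.1, hv.2⟩, fun v hv hv' => ?_⟩
    -- A state that is not a candidate has no edge into `cur`, so a response evading `swin \ cur`
    -- evades all of `swin`.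
    refine or_iff_not_imp_left.2 fun hvc y hy => ?_
    obtain ⟨x, hx, h₁, h₂⟩ := h.2 v hv hv' y hy
    refine ⟨x, hx, h₁, fun h₃ => ?_⟩
    by_cases h₄ : v.step (x ∪ y) ∈ cur
    · exact hvc ⟨⟨hv, x, hx, y, hy, h₄⟩, hv'⟩
    · exact h₂ ⟨h₃.1, h₄⟩
  | candYes s C cand new ps g v hv hs =>
    obtain ⟨h₁, h₂, h₃, h₄⟩ := h
    have hP := h₁.reclassify (reclassifies_recordSwin X Y g v) (h₁.good.sound.recordSwin v)
    have hP' := hP.reclassify (reclassifies_markSwin (hP.known v (h₃ hv).1))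
      (hP.good.sound.markSwin hs)
    refine ⟨hP', Set.insert_subset_insert h₂, fun w hw => ⟨(h₃ hw.1).1, (h₃ hw.1).2, hw.2⟩,
      fun w hw hw' => ?_⟩
    -- As v enters both `swin` and `new`, the set `swin \ new` does not grow.
    refine (h₄ w hw hw'.1).imp (fun h' => ⟨h', hw'.2⟩) fun h' => h'.mono ?_
    rintro t ⟨ht | ht, ht'⟩
    · exact absurd (Or.inl ht) ht'
    · exact ⟨ht, fun h'' => ht' (Or.inr h'')⟩
  | candNo s C cand new ps g v hv hs =>
    obtain ⟨h₁, h₂, h₃, h₄⟩ := h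
    refine ⟨h₁.reclassify (reclassifies_recordSwin X Y g v) (h₁.good.sound.recordSwin v), h₂,
      fun w hw => h₃ hw.1, fun w hw hw' => ?_⟩
    -- The failed test shows that v evades all of the present `swin`; whatever enters it later in
    -- the round enters `new` too.
    by_cases hwv : w = v
    · subst hwv
      exact Or.inr ((evades_of_not_sysWinning hs).mono Set.sdiff_subset)
    · exact (h₄ w hw hw').imp_left fun h' => ⟨h', hwv⟩
  | nextRound s C new ps g hn =>
    obtain ⟨h₁, h₂, h₃, h₄⟩ := h
    have hsw : g.swin ∪ new = g.swin := Set.union_eq_self_of_subset_right h₂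
    have hS := h₁.good.sound
    refine ⟨h₁.reclassify (reclassifies_nextRound h₂) ⟨?_, hS.2, ?_, hS.4⟩, fun v hv hv' => ?_⟩
    · rw [hsw]
      exact hS.1
    · rw [hsw]
      exact hS.3
    · rw [hsw]
      exact (h₄ v hv hv'.1).resolve_left (Set.notMem_empty v)
  | lastRound s C ps g =>
    obtain ⟨h₁, h₂, h₃, h₄⟩ := h
    refine Or.inr ⟨h₁.finish fun v hv hv' => ?_, fun hps => ?_⟩
    · simpa using h₄ v hv hv'
    · by_cases h' : cls φ ∈ g.swin
      · exact Or.inl h'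
      · exact Or.inr (Or.inr ⟨h₁.initial_mem hps, h'⟩)
  | back s p ps g =>
    rcases h with h | h
    · exact h.1.back h.2.1
    · exact h.1.lower p _
  | yes s g hs =>
    rcases h with h | h
    · exact absurd rfl h.2.2
    · exact h.1.sound.swin_win _ hs
  | no s g hs =>
    rcases h with h | h
    · exact absurd rfl h.2.2
    · exact h.1.sound.not_win ((h.2 rfl).resolve_left hs)

theorem inv_of_exec {φ : LTLf α} {X Y : Finset α} {c : Config α} {t : ℕ} (h : Exec φ X Y t c) :
    Inv φ X Y c := by
  induction h with
  | start => exact good_init φ X Y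
  | step _ h' ih => exact inv_step ih h'

theorem exists_step {φ : LTLf α} {X Y : Finset α} {c : Config α} (h : Inv φ X Y c) :
    (∃ v, c.control = .halt v) ∨ ∃ k c', Step φ X Y c k c' := by
  match c, h with
  | ⟨.loop s, ps, g⟩, h =>
    by_cases h₁ : SysWinning X Y g s
    · exact Or.inr ⟨_, _, .checkSys s ps g h₁⟩
    by_cases h₂ : EnvWinning X Y g s
    · exact Or.inr ⟨_, _, .checkEnv s ps g h₁ h₂⟩
    · exact Or.inr ⟨_, _, .checkUnknown s ps g h₁ h₂⟩
  | ⟨.explore s W, ps, g⟩, h =>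
    rcases W.eq_empty_or_nonempty with rfl | ⟨e, he⟩
    · exact Or.inr ⟨_, _, .noEdge s ps g⟩
    by_cases h₁ : s.step e ∈ g.undet
    · exact Or.inr ⟨_, _, .undetEdge s W ps g e he h₁⟩
    · exact Or.inr ⟨_, _, .call s W ps g e he h₁⟩
  | ⟨.exit s, ps, g⟩, h =>
    by_cases h₁ : g.low s = g.index s
    · obtain ⟨C, rest, h₂, h₃⟩ :=
        List.eq_append_cons_of_mem (h.1.tarjan.act_sub s List.mem_cons_self)
      exact Or.inr ⟨_, _, .root s ps g h₁ C rest h₃ h₂⟩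
    · exact Or.inr ⟨_, _, .notRoot s ps g h₁⟩
  | ⟨.backward s C cur, ps, g⟩, h => exact Or.inr ⟨_, _, .round s C cur ps g⟩
  | ⟨.candidates s C cand new, ps, g⟩, h =>
    rcases cand.eq_empty_or_nonempty with rfl | ⟨v, hv⟩
    · rcases new.eq_empty_or_nonempty with rfl | hn
      · exact Or.inr ⟨_, _, .lastRound s C ps g⟩
      · exact Or.inr ⟨_, _, .nextRound s C new ps g hn⟩
    by_cases h₁ : SysWinning X Y g v
    · exact Or.inr ⟨_, _, .candYes s C cand new ps g v hv h₁⟩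
    · exact Or.inr ⟨_, _, .candNo s C cand new ps g v hv h₁⟩
  | ⟨.return s, [], g⟩, _ =>
    by_cases h₁ : cls φ ∈ g.swin
    · exact Or.inr ⟨_, _, .yes s g h₁⟩
    · exact Or.inr ⟨_, _, .no s g h₁⟩
  | ⟨.return s, p :: ps, g⟩, _ => exact Or.inr ⟨_, _, .back s p ps g⟩
  | ⟨.halt v, _, _⟩, _ => exact Or.inl ⟨v, rfl⟩

/-! ### Running time -/

/-- The number of the states that have not been visited. -/
noncomputable def unvisited (φ : LTLf α) (g : Store α) : ℕ :=
  (closureStates φ \ {v | g.Known v}).ncard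

theorem unvisited_anti {φ : LTLf α} {g g' : Store α} (h : ∀ v, g.Known v → g'.Known v) :
    unvisited φ g' ≤ unvisited φ g :=
  Set.ncard_le_ncard (fun _ hv => ⟨hv.1, fun h' => hv.2 (h _ h')⟩)
    ((finite_closureStates φ).subset Set.sdiff_subset)

theorem unvisited_visit {φ : LTLf α} {g : Store α} {t : State α} (ht : t ∈ closureStates φ)
    (ht' : ¬ g.Known t) : unvisited φ (g.visit t) + 1 ≤ unvisited φ g := by
  refine Set.ncard_lt_ncard ⟨fun v hv => ⟨hv.1, fun h' => hv.2 (h'.imp_left Or.inr)⟩, fun h' => ?_⟩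
    ((finite_closureStates φ).subset Set.sdiff_subset)
  exact (h' ⟨ht, ht'⟩).2 (Or.inl (Set.mem_insert t g.undet))

/-- The number of the undetermined states of a component. -/
noncomputable def undetCount {α : Type u} (C : List (State α)) (g : Store α) : ℕ :=
  ({v | v ∈ C} ∩ g.undet).ncard

omit [DecidableEq α] in
theorem finite_mem (C : List (State α)) : {v | v ∈ C}.Finite := C.finite_toSet

omit [DecidableEq α] in
theorem ncard_le_length {C : List (State α)} {S : Set (State α)} (h : S ⊆ {v | v ∈ C}) :
    S.ncard ≤ C.length := by
  classical
  have h' : S ⊆ (C.toFinset : Set (State α)) := fun v hv => List.mem_toFinset.2 (h hv)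
  calc S.ncard ≤ (C.toFinset : Set (State α)).ncard :=
        Set.ncard_le_ncard h' C.toFinset.finite_toSet
    _ = C.toFinset.card := Set.ncard_coe_finset _
    _ ≤ C.length := C.toFinset_card_le

omit [DecidableEq α] in
theorem undetCount_mono {C : List (State α)} {g g' : Store α} (h : g'.undet ⊆ g.undet) :
    undetCount C g' ≤ undetCount C g :=
  Set.ncard_le_ncard (Set.inter_subset_inter_right _ h) ((finite_mem C).inter_of_left _)

omit [DecidableEq α] in
theorem undetCount_markSwin {C : List (State α)} {g : Store α} {v : State α} (hv : v ∈ C)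
    (hv' : v ∈ g.undet) : undetCount C (g.markSwin v) + 1 ≤ undetCount C g := by
  refine Set.ncard_lt_ncard ⟨Set.inter_subset_inter_right _ Set.sdiff_subset, fun h => ?_⟩
    ((finite_mem C).inter_of_left _)
  exact (h ⟨hv, hv'⟩).2.2 rfl

open Classical in
/-- A bound on the cost of the steps up to the next return, without recursive calls; `E` is the
number of the edges of a state. -/
noncomputable def controlFuel {α : Type u} (E : ℕ) : Control α → Store α → ℕ
  | .loop _, _ => 4 * E + 6
  | .explore _ W, _ => W.ncard + 5
  | .exit _, _ => 4
  | .backward _ C _, g => (undetCount C g + 1) * (C.length * (2 * E + 2) + 2) + 1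
  | .candidates _ C cand new, g => cand.ncard * (E + 1) + C.length + 2 +
      (undetCount C g + if new.Nonempty then 1 else 0) * (C.length * (2 * E + 2) + 2)
  | .return _, _ => 1
  | .halt _, _ => 0

/-- The share of a state on the stack in the cost of the backward search on its component, if there
are `N` states with `E` edges each. -/
def stackFuel (N E : ℕ) : ℕ := (N + 1) * (2 * E + 2) + 3

/-- A bound on the cost of the remaining steps. -/
noncomputable def fuel (φ : LTLf α) (X Y : Finset α) (c : Config α) : ℕ :=
  (stackFuel (closureStates φ).ncard (2 ^ (X ∪ Y).card) + 2 * (4 * 2 ^ (X ∪ Y).card + 6)) *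
      unvisited φ c.store +
    stackFuel (closureStates φ).ncard (2 ^ (X ∪ Y).card) * c.store.stack.length +
    (4 * 2 ^ (X ∪ Y).card + 6) * c.callers.length +
    controlFuel (2 ^ (X ∪ Y).card) c.control c.store

/-- A step that visits no state does not need more fuel for the stack and the unvisited states. -/
theorem cost_add_fuel_le {φ : LTLf α} {X Y : Finset α} {ctrl ctrl' : Control α}
    {ps : List (State α)} {g g' : Store α} {k : ℕ} (h : ∀ v, g.Known v → g'.Known v)
    (hs : g'.stack = g.stack)
    (hk : k + controlFuel (2 ^ (X ∪ Y).card) ctrl' g' ≤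
      controlFuel (2 ^ (X ∪ Y).card) ctrl g) :
    k + fuel φ X Y ⟨ctrl', ps, g'⟩ ≤ fuel φ X Y ⟨ctrl, ps, g⟩ := by
  have h₁ := Nat.mul_le_mul_left (stackFuel (closureStates φ).ncard (2 ^ (X ∪ Y).card) +
    2 * (4 * 2 ^ (X ∪ Y).card + 6)) (unvisited_anti (φ := φ) h)
  simp only [fuel, hs]
  omega

theorem ncard_edges_le {X Y : Finset α} {W : Set (Finset α)}
    (h : W ⊆ ((X ∪ Y).powerset : Set (Finset α))) : W.ncard ≤ 2 ^ (X ∪ Y).card := by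
  refine (Set.ncard_le_ncard h (Finset.finite_toSet _)).trans ?_
  rw [Set.ncard_coe_finset, Finset.card_powerset]

theorem cost_add_fuel_le_of_step {φ : LTLf α} {X Y : Finset α} {c c' : Config α} {k : ℕ}
    (h : Inv φ X Y c) (h' : Step φ X Y c k c') : k + fuel φ X Y c' ≤ fuel φ X Y c := by
  classical
  cases h' with
  | checkSys s ps g hs =>
    have h₀ : Good φ X Y (s :: ps) [] g := h
    refine cost_add_fuel_le (fun v => ((reclassifies_recordSwin X Y g s).trans
      (reclassifies_markSwin h₀.known_head)).known_iff v |>.2) rfl ?_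
    simp only [controlFuel]
    omega
  | checkEnv s ps g hs he =>
    have h₀ : Good φ X Y (s :: ps) [] g := h
    refine cost_add_fuel_le (fun v => (((reclassifies_recordSwin X Y g s).trans
      (reclassifies_recordEwin X Y _ s)).trans
        (reclassifies_markEwin h₀.known_head)).known_iff v |>.2) rfl ?_
    simp only [controlFuel]
    omega
  | checkUnknown s ps g hs he =>
    have h₀ : Good φ X Y (s :: ps) [] g := h
    refine cost_add_fuel_le (fun v hv => hv) rfl ?_
    -- The loop allowance 4E + 6 splits into 3E + 1 for this step, at most E for the listed edges,
    -- and 5.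
    have := ncard_edges_le (exploring_of_unknown h₀.sound hs).sub
    simp only [controlFuel]
    omega
  | noEdge s ps g =>
    refine cost_add_fuel_le (fun v hv => hv) rfl ?_
    simp [controlFuel]
  | undetEdge s W ps g e he hu =>
    refine cost_add_fuel_le (fun v hv => hv) rfl ?_
    have := Set.ncard_sdiff_singleton_lt_of_mem he ((Finset.finite_toSet _).subset h.2.sub)
    simp only [controlFuel]
    omega
  | call s W ps g e he hu =>
    have hv := unvisited_visit (step_mem_closureStates (h.1.book.known_reach s h.1.known_head) e)
      (not_or.2 ⟨hu, not_or.2 (h.2.fresh e he)⟩)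
    -- The share of the newly visited state pays for its place on the stack, for its own pass
    -- through the loop, and for one more pass of the caller after the return; the step itself is
    -- paid by `explore`.
    have h₁ := Nat.mul_le_mul_left (stackFuel (closureStates φ).ncard (2 ^ (X ∪ Y).card) +
      2 * (4 * 2 ^ (X ∪ Y).card + 6)) hv
    have hstack : (g.visit (s.step e)).stack.length = g.stack.length + 1 := rfl
    simp only [fuel, controlFuel, List.length_cons, hstack]
    rw [Nat.mul_add, Nat.mul_one] at h₁
    rw [Nat.mul_add_one _ ps.length, Nat.mul_add_one _ g.stack.length]
    omega
  | notRoot s ps g hr =>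
    refine cost_add_fuel_le (fun v hv => hv) rfl ?_
    simp [controlFuel]
  | root s ps g hr C rest _ hstack =>
    have hP := (h.1.pop h.2 hr hstack).1.length_le
    have hu : undetCount (s :: C) { g with stack := rest } ≤ (s :: C).length :=
      ncard_le_length Set.inter_subset_left
    have hl : g.stack.length = (s :: C).length + rest.length := by
      rw [hstack]
      simp only [List.length_append, List.length_cons]
      omega
    have hv : unvisited φ { g with stack := rest } = unvisited φ g := rfl
    simp only [fuel, controlFuel, hv, hl, stackFuel]
    generalize (s :: C).length = m at *
    generalize undetCount (s :: C) { g with stack := rest } = u at *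
    generalize (closureStates φ).ncard = N at *
    generalize 2 ^ (X ∪ Y).card = E at *
    -- The m stack shares and the 4 units of `exit` pay m + 1 for the pop and at most m + 1 rounds;
    -- the balance is exact when u = m = N.
    have h₁ : (u + 1) * (m * (2 * E + 2) + 2) ≤ (m + 1) * (m * (2 * E + 2) + 2) :=
      Nat.mul_le_mul_right _ (Nat.succ_le_succ hu)
    have h₂ : (m + 1) * ((2 * E + 2) * m) ≤ (N + 1) * ((2 * E + 2) * m) :=
      Nat.mul_le_mul_right _ (Nat.succ_le_succ hP)
    nlinarith
  | round s C cur ps g =>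
    refine cost_add_fuel_le (fun v hv => hv) rfl ?_
    have hc : (directPredecessors X Y cur C ∩ g.undet).ncard ≤ C.length :=
      ncard_le_length fun v hv => hv.1.1
    simp only [controlFuel, Set.not_nonempty_empty, if_false]
    -- A round is allotted |C|(2E + 2) + 2: |C|E + 1 to find the candidates, |C|(E + 1) to test
    -- them, |C| + 1 to close it.
    have h₁ := Nat.mul_le_mul_right (2 ^ (X ∪ Y).card + 1) hc
    nlinarith
  | candYes s C cand new ps g v hv hs =>
    obtain ⟨h₁, h₂, h₃, h₄⟩ := h
    refine cost_add_fuel_le (fun w => ((reclassifies_recordSwin X Y g v).trans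
      (reclassifies_markSwin (h₁.known v (h₃ hv).1))).known_iff w |>.2) rfl ?_
    have hc := Set.ncard_sdiff_singleton_add_one hv
      (((finite_mem C).inter_of_left _).subset h₃)
    have hu : undetCount C ((g.recordSwin X Y v).markSwin v) + 1 ≤ undetCount C g :=
      undetCount_markSwin (g := g.recordSwin X Y v) (h₃ hv).1 (h₃ hv).2
    simp only [controlFuel, Set.insert_nonempty, if_true]
    -- Classifying v lowers the undetermined count by one, and this pays for the further round that
    -- a non-empty `new` entails.
    have h₅ := Nat.mul_le_mul_right (C.length * (2 * 2 ^ (X ∪ Y).card + 2) + 2)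
      (hu.trans (Nat.le_add_right _ (if new.Nonempty then 1 else 0)))
    rw [← hc, Nat.add_mul (cand \ {v}).ncard]
    omega
  | candNo s C cand new ps g v hv hs =>
    obtain ⟨h₁, h₂, h₃, h₄⟩ := h
    refine cost_add_fuel_le (fun v hv => hv) rfl ?_
    have hc := Set.ncard_sdiff_singleton_add_one hv
      (((finite_mem C).inter_of_left _).subset h₃)
    have hu : undetCount C (g.recordSwin X Y v) = undetCount C g := rfl
    simp only [controlFuel, hu]
    rw [← hc, Nat.add_mul (cand \ {v}).ncard]
    omega
  | nextRound s C new ps g hn =>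
    obtain ⟨h₁, h₂, h₃, h₄⟩ := h
    refine cost_add_fuel_le (fun v => (reclassifies_nextRound h₂).known_iff v |>.2) rfl ?_
    have hu : undetCount C { g with swin := g.swin ∪ new, undet := g.undet \ new } ≤
        undetCount C g := undetCount_mono Set.sdiff_subset
    simp only [controlFuel, hn, if_true]
    have h₅ := Nat.mul_le_mul_right (C.length * (2 * 2 ^ (X ∪ Y).card + 2) + 2)
      (Nat.succ_le_succ hu)
    simp only [Nat.succ_eq_add_one] at h₅
    omega
  | lastRound s C ps g =>
    refine cost_add_fuel_le (fun v => h.1.reclassifies_finish.known_iff v |>.2) rfl ?_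
    simp only [controlFuel]
    omega
  | back s p ps g =>
    have hv : unvisited φ (g.lower p (g.low s)) = unvisited φ g := rfl
    have hl : (g.lower p (g.low s)).stack = g.stack := rfl
    simp only [fuel, controlFuel, hv, hl, List.length_cons]
    rw [Nat.mul_add_one _ ps.length]
    omega
  | yes s g hs => exact cost_add_fuel_le (fun v hv => hv) rfl (by simp [controlFuel])
  | no s g hs => exact cost_add_fuel_le (fun v hv => hv) rfl (by simp [controlFuel])

theorem fuel_init_le (φ : LTLf α) (X Y : Finset α) :
    fuel φ X Y (init φ) ≤ 208 * (2 ^ (X ∪ Y).card * 2 ^ 2 ^ φ.tcl.card) := by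
  have hN : 1 ≤ (closureStates φ).ncard :=
    (Set.ncard_pos (finite_closureStates φ)).2 ⟨_, cls_mem_closureStates φ⟩
  have hE : 1 ≤ 2 ^ (X ∪ Y).card := Nat.one_le_two_pow
  have hN' := ncard_closureStates_sq_le φ
  have hu : unvisited φ (init φ).store ≤ (closureStates φ).ncard :=
    Set.ncard_le_ncard Set.sdiff_subset (finite_closureStates φ)
  have hs : (init φ).store.stack.length = 1 := rfl
  have hc : (init φ).callers.length = 0 := rfl
  have hf : controlFuel (2 ^ (X ∪ Y).card) (init φ).control (init φ).store =
    4 * 2 ^ (X ∪ Y).card + 6 := rfl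
  simp only [fuel, hs, hc, hf]
  generalize unvisited φ (init φ).store = U at *
  generalize (closureStates φ).ncard = N at *
  generalize 2 ^ (X ∪ Y).card = E at *
  generalize 2 ^ 2 ^ φ.tcl.card = T at *
  have hNE : 1 ≤ N * E := Nat.mul_pos hN hE
  have hEN : E ≤ N * E := Nat.le_mul_of_pos_left E hN
  have hNN : N * E ≤ N ^ 2 * E := Nat.mul_le_mul_right E (Nat.le_self_pow two_ne_zero N)
  have hB : stackFuel N E ≤ 11 * (N * E) := by
    have : N ≤ N * E := Nat.le_mul_of_pos_right N hE
    simp only [stackFuel]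
    nlinarith
  -- Here 31 = 11 + 20. One stack share (11) and one loop allowance (10) are added to it, giving 52
  -- N²E in total; N² ≤ 4T then yields 208.
  have hA : (stackFuel N E + 2 * (4 * E + 6)) * U ≤ 31 * (N * E) * N :=
    Nat.mul_le_mul (by omega) hu
  have hT : N ^ 2 * E ≤ 4 * T * E := Nat.mul_le_mul_right E hN'
  have hA' : 31 * (N * E) * N = 31 * (N ^ 2 * E) := by ring
  have hT' : 4 * T * E = 4 * (E * T) := by ring
  omega

theorem time_add_fuel_le {φ : LTLf α} {X Y : Finset α} {c : Config α} {t : ℕ}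
    (h : Exec φ X Y t c) : t + fuel φ X Y c ≤ fuel φ X Y (init φ) := by
  induction h with
  | start => exact (Nat.zero_add _).le
  | step h h' ih =>
    have := cost_add_fuel_le_of_step (inv_of_exec h) h'
    omega

theorem cost_pos {φ : LTLf α} {X Y : Finset α} {c c' : Config α} {k : ℕ}
    (h : Step φ X Y c k c') : 0 < k := by
  cases h <;> exact Nat.succ_pos _

/-- Each step uses up at least one unit of fuel, so an execution cannot be continued forever, and by
`exists_step` it can get stuck only at an answer. -/
theorem exists_returns_of_exec {φ : LTLf α} {X Y : Finset α} (n : ℕ) :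
    ∀ (t : ℕ) (c : Config α), Exec φ X Y t c → fuel φ X Y c ≤ n → ∃ v, Returns φ X Y v := by
  induction n with
  | zero =>
    intro t c h hn
    rcases exists_step (inv_of_exec h) with ⟨v, hv⟩ | ⟨k, c', h'⟩
    · exact ⟨v, t, c, h, hv⟩
    · have h₁ := cost_add_fuel_le_of_step (inv_of_exec h) h'
      have h₂ := cost_pos h'
      omega
  | succ n ih =>
    intro t c h hn
    rcases exists_step (inv_of_exec h) with ⟨v, hv⟩ | ⟨k, c', h'⟩
    · exact ⟨v, t, c, h, hv⟩
    · have h₁ := cost_add_fuel_le_of_step (inv_of_exec h) h'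
      have h₂ := cost_pos h'
      exact ih (t + k) c' (.step h h') (by omega)

theorem exists_returns (φ : LTLf α) (X Y : Finset α) : ∃ v, Returns φ X Y v :=
  exists_returns_of_exec _ 0 (init φ) .start le_rfl

theorem terminatesWithin (φ : LTLf α) (X Y : Finset α) :
    TerminatesWithin φ X Y (208 * (2 ^ (X ∪ Y).card * 2 ^ 2 ^ φ.tcl.card)) := fun _ _ h =>
  ⟨(Nat.le_add_right _ _).trans ((time_add_fuel_le h).trans (fuel_init_le φ X Y)),
    exists_step (inv_of_exec h)⟩

theorem win_of_returns {φ : LTLf α} {X Y : Finset α} (h : Returns φ X Y .realizable) :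
    Win X Y (cls φ) := by
  obtain ⟨t, ⟨ctrl, ps, g⟩, h, rfl⟩ := h
  exact inv_of_exec h

theorem not_win_of_returns {φ : LTLf α} {X Y : Finset α} (h : Returns φ X Y .unrealizable) :
    ¬ Win X Y (cls φ) := by
  obtain ⟨t, ⟨ctrl, ps, g⟩, h, rfl⟩ := h
  exact inv_of_exec h

end OnTheFly

/-! ### The main theorem -/

theorem mainTheorem5 :
    ∃ K : ℕ, ∀ (α : Type u) [DecidableEq α] (φ : LTLf α) (X Y : Finset α),
      Disjoint X Y → φ.atoms ⊆ X ∪ Y →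
        OnTheFly.TerminatesWithin φ X Y (K * (2 ^ (X ∪ Y).card * 2 ^ 2 ^ φ.tcl.card)) ∧
        (φ.MooreRealizable X Y ↔ OnTheFly.Returns φ X Y .realizable) ∧
        (¬ φ.MooreRealizable X Y ↔ OnTheFly.Returns φ X Y .unrealizable) := by
  refine ⟨208, fun α _ φ X Y _ _ => ⟨OnTheFly.terminatesWithin φ X Y, ?_⟩⟩
  rw [LTLf.mooreRealizable_iff_win]
  -- Some execution returns a verdict, and every returned verdict is correct; hence no execution
  -- returns the other one, and both equivalences follow.
  obtain ⟨_ | _, hv⟩ := OnTheFly.exists_returns φ X Y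
  · have hw := OnTheFly.win_of_returns hv
    exact ⟨iff_of_true hw hv, iff_of_false (not_not_intro hw)
      fun h => OnTheFly.not_win_of_returns h hw⟩
  · have hw := OnTheFly.not_win_of_returns hv
    exact ⟨iff_of_false hw fun h => hw (OnTheFly.win_of_returns h), iff_of_true hw hv⟩
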